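/- **Theorem.** Let $m,n\ge 0$ be integers and let $X$ be the affine space $\mathbb C^m$ with coordinates $x=(x_p)$, or the projective space $\mathbb P^m$ with $m+1$ homogeneous coordinates $x=(x_p)$. Let $M$ ($=m$, resp. $m+1$) be the number of coordinates, let $J_1,\dots,J_n\subset\mathbb Z_{\ge0}^{M}$ be finite sets, and let $$f=f_a=(f_1,\dots,f_n),\qquad f_i(x)=\sum_{j\in J_i}a_{ij}x^j ,\qquad a=(a_{ij}).$$ Let $g$ be a (possibly multivalued) holomorphic function on an open set $D\subset\mathbb C^n$, continuable along all paths in $D$, with $z_i\,\partial g/\partial z_i=\alpha_i g$ for $1\le i\le n$, $\alpha_i\in\mathbb C$. Let $\omega$ be a (possibly multivalued) holomorphic differential $m$-form on an open set $E\subset\mathbb C^{M}$, continuable along all paths in $E$, with $L_{x_p\partial/\partial x_p}\,\omega=\beta_p\,\omega$ for every $p$, where $\beta_p\in\mathbb C$ and $L$ is the Lie derivative (for example $\omega=\prod_p x_p^{\beta_p-1}\,dx_1\wedge\dots\wedge dx_m$ in the affine case). In the projective case assume moreover that $g(f(x))\omega$ is the expression in homogeneous coordinates of an $m$-form on $\mathbb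 P^m$: $0\notin E$, every $j\in J_i$ has $\sum_pj_p=d_i$ (that is, $f_i$ is homogeneous of degree $d_i$), $\omega$ is annihilated by contraction with the Euler field $\sum_p x_p\partial/\partial x_p$, and $\sum_i d_i\alpha_i+\sum_p\beta_p=0$. For given $a$, let $\mathcal L_a$ be the local system on $X_a=\{x\in E: f_a(x)\in D\}$ (in the projective case, on its image in $\mathbb P^m$) spanned by the branches of $g(f_a(x))\omega$, that is, the pullback under $x\mapsto(f_a(x),x)$ of the local system spanned by the products of a branch of $g(z)$ and a branch of $\omega(x)$. Consider $m$-dimensional smooth singular (cubical) cycles $C$ in $X_a$ (in the projective case, in its image in $\mathbb P^m$) with values in $\mathcal L_a$; in the projective case the cubes are given by lifts to $X_a$, and two lifts that differ by a smooth nowhere vanishing scalar function $\lambda$ are identified, their coefficients being identified by pullback under $(z_i,x)\mapsto(\lambda^{d_i}z_i,\lambda x)$. Then: 1. For every $a_0$, every $m$-cycle $C$ with values in $\mathcal L_{a_0}$ extends to all $a$ in an open neighbourhood $U$ of $a_0$: the singular cubes are kept fixed, their coefficients are continued analytically in $a$, and the result is a cycle with values in $\mathcal L_a$ for $a\in U$.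 2. Whenever $C$ is such an analytically continued cycle over an open set $U$ of coefficients, the period $$\Phi(a)=\oint_C g(f_a(x))\,\omega$$ is holomorphic on $U$ and is an $A$-hypergeometric function of the $a_{ij}$, for the set $A$ of vectors $(e_i,j)\in\mathbb Z^{n}\oplus\mathbb Z^{M}$, $1\le i\le n$, $j\in J_i$, and the exponent $(\alpha,-\beta)$. That is, $$\sum_{j}a_{i_0j}\frac{\partial\Phi}{\partial a_{i_0j}}=\alpha_{i_0}\Phi\quad\text{for every } i_0,\qquad \sum_{i,j}j_p\,a_{ij}\frac{\partial\Phi}{\partial a_{ij}}=-\beta_p\Phi\quad\text{for every } p,$$ and $$\frac{\partial^q\Phi}{\partial a_{i_1j_{(1)}}\cdots\partial a_{i_qj_{(q)}}}=\frac{\partial^{q'}\Phi}{\partial a_{i'_1j'_{(1)}}\cdots\partial a_{i'_{q'}j'_{(q')}}}\quad\text{whenever}\quad\sum_s(e_{i_s},j_{(s)})=\sum_s(e_{i'_s},j'_{(s)}).$$ -/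

import Mathlib

open Filter Topology

namespace AHyp

/-- The two kinds of source space: affine space `ℂᵐ` or projective space `ℙᵐ`. -/
inductive Ambient where
  | affine
  | projective

/-- Number of coordinates: `m` affine coordinates on `ℂᵐ`, and `m + 1` homogeneous
coordinates on `ℙᵐ`. -/
def Ambient.coords : Ambient → ℕ → ℕ
  | .affine, m => m
  | .projective, m => m + 1

/-- Values of complex differential `m`-forms (of type `(m,0)`) in the variables `x_p`, `p < M`. -/
abbrev Form (M m : ℕ) : Type := (Fin M → ℂ) [⋀^Fin m]→L[ℂ] ℂ

/-- A multivalued holomorphic function on the open set `D` with values in `F`, given by all of its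
local branches: `IsBranch z b` says that the germ at `z` of the function element `b` is a branch.
The germs of branches form a covering of `D`: every point of `D` has a neighbourhood `B` in `D`
over which the branches are given by one set of holomorphic functions on `B`.  (Equivalently,
every branch can be continued analytically along every path in `D`.) -/
structure MultivaluedHol {V F : Type*} [NormedAddCommGroup V] [NormedSpace ℂ V]
    [NormedAddCommGroup F] [NormedSpace ℂ F] (D : Set V) where
  IsBranch : V → (V → F) → Prop
  locallyConstant : ∀ z₀ ∈ D, ∃ B : Set V, IsOpen B ∧ z₀ ∈ B ∧ B ⊆ D ∧
    ∃ S : Set (V → F), (∀ s ∈ S, DifferentiableOn ℂ s B) ∧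
      ∀ z ∈ B, ∀ b : V → F, IsBranch z b ↔ ∃ s ∈ S, b =ᶠ[𝓝 z] s

/-- `g` is quasi-homogeneous: `z_i ∂g/∂z_i = α_i g` for every `i` (and every branch of `g`). -/
def QuasiHomogeneousFun {n : ℕ} {D : Set (Fin n → ℂ)} (g : MultivaluedHol (F := ℂ) D)
    (α : Fin n → ℂ) : Prop :=
  ∀ z ∈ D, ∀ b, g.IsBranch z b → ∀ i, z i * fderiv ℂ b z (Pi.single i 1) = α i * b z

/-- The Lie derivative of the form `w` along the vector field `x_p ∂/∂x_p`, at the point `x`,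
evaluated on the vectors `u`. -/
noncomputable def lieDeriv {M m : ℕ} (p : Fin M) (w : (Fin M → ℂ) → Form M m) (x : Fin M → ℂ)
    (u : Fin m → Fin M → ℂ) : ℂ :=
  fderiv ℂ w x (Pi.single p (x p)) u
    + ∑ q, w x (Function.update u q (Pi.single p (u q p)))

/-- `η` is quasi-homogeneous: `x_p ∂η/∂x_p = β_p η` for every `p` (and every branch of `η`), where
`x_p ∂/∂x_p` acts on forms by the Lie derivative; for example
`η = x₁^(β₁-1) ⋯ x_m^(β_m-1) dx₁ ∧ ⋯ ∧ dx_m`. -/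
def QuasiHomogeneousForm {M m : ℕ} {E : Set (Fin M → ℂ)} (η : MultivaluedHol (F := Form M m) E)
    (β : Fin M → ℂ) : Prop :=
  ∀ x ∈ E, ∀ w, η.IsBranch x w → ∀ p u, lieDeriv p w x u = β p * w x u

/-- Indices of the coefficients `a_{ij}`, `j ∈ J_i`, of polynomials `f_1, …, f_n` with exponents
in the finite sets `J_i`. -/
abbrev Idx {M n : ℕ} (J : Fin n → Finset (Fin M → ℕ)) : Type := Σ i : Fin n, J i

/-- The polynomial map `f_a`, with `f_i(x) = ∑_{j ∈ J_i} a_{ij} x^j`. -/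
noncomputable def polyMap {M n : ℕ} (J : Fin n → Finset (Fin M → ℕ)) (a : Idx J → ℂ)
    (x : Fin M → ℂ) : Fin n → ℂ :=
  fun i => ∑ j : J i, a ⟨i, j⟩ * ∏ p, x p ^ (j.1 p)

/-- The point `(f_a(x), x)`. -/
noncomputable def graphPt {M n : ℕ} (J : Fin n → Finset (Fin M → ℕ)) (a : Idx J → ℂ)
    (x : Fin M → ℂ) : (Fin n → ℂ) × (Fin M → ℂ) :=
  (polyMap J a x, x)

/-- In the projective case `x` are homogeneous coordinates on `ℙᵐ`, `f_i` is homogeneous of degree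
`d_i`, and these conditions say that `g(f(x)) η` comes from a multivalued `m`-form on `ℙᵐ`: it is
killed by contraction with the Euler vector field `∑ x_p ∂/∂x_p`, and it has total degree `0`. -/
structure DescendsToProjective {M m n : ℕ} (J : Fin n → Finset (Fin M → ℕ)) (d : Fin n → ℕ)
    {E : Set (Fin M → ℂ)} (η : MultivaluedHol (F := Form M m) E)
    (α : Fin n → ℂ) (β : Fin M → ℂ) : Prop where
  homogeneous : ∀ i, ∀ j ∈ J i, ∑ p, j p = d i
  zero_notMem : (0 : Fin M → ℂ) ∉ E
  contraction : ∀ x ∈ E, ∀ w, η.IsBranch x w → ∀ (u : Fin m → Fin M → ℂ) (q : Fin m),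
    u q = x → w x u = 0
  degree : ∑ i, (d i : ℂ) * α i + ∑ p, β p = 0

/-- The local system determined by the multivalued expression `g(z) η(x)`: its stalk at the point
`y = (z, x)` is the complex vector space spanned by the germs of the branches
`(z', x') ↦ b(z') w(x')`.  A function element `s` represents an element of the stalk. -/
def InLocalSystem {M m n : ℕ} {D : Set (Fin n → ℂ)} {E : Set (Fin M → ℂ)}
    (g : MultivaluedHol (F := ℂ) D) (η : MultivaluedHol (F := Form M m) E)
    (y : (Fin n → ℂ) × (Fin M → ℂ)) (s : (Fin n → ℂ) × (Fin M → ℂ) → Form M m) : Prop :=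
  ∃ K ∈ Submodule.span ℂ {K : (Fin n → ℂ) × (Fin M → ℂ) → Form M m |
      ∃ b w, g.IsBranch y.1 b ∧ η.IsBranch y.2 w ∧ K = fun y' => b y'.1 • w y'.2},
    s =ᶠ[𝓝 y] K

/-- The standard cube `[0,1]^k`. -/
abbrev cube (k : ℕ) : Set (Fin k → ℝ) := Set.Icc 0 1

/-- A smooth singular `k`-cube with a coefficient in the local system of `g(f_a(x)) η`, depending on
the parameter `a ∈ U`.  The cube `map` lies in `{x ∈ E : f_a(x) ∈ D}` for every `a ∈ U`; only its
restriction to `[0,1]^k` matters.  The coefficient `coeff` is a section of the local system along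
`(a, t) ↦ (f_a(x), x)`, `x = map t`, over `U × [0,1]^k`: a locally constant choice of elements of
its stalks, each given by a function element.  For `U = {a}` this is a cube in `{f_a(x) ∈ D}` with
a coefficient in the local system; for open `U`, it is one whose coefficient is continued
analytically in `a`. -/
structure LoadedCube {M m n : ℕ} (J : Fin n → Finset (Fin M → ℕ)) {D : Set (Fin n → ℂ)}
    {E : Set (Fin M → ℂ)} (g : MultivaluedHol (F := ℂ) D)
    (η : MultivaluedHol (F := Form M m) E) (U : Set (Idx J → ℂ)) (k : ℕ) where
  map : (Fin k → ℝ) → Fin M → ℂ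
  coeff : (Idx J → ℂ) → (Fin k → ℝ) → (Fin n → ℂ) × (Fin M → ℂ) → Form M m
  smooth : ContDiff ℝ (⊤ : ℕ∞) map
  map_mem : ∀ t ∈ cube k, map t ∈ E
  polyMap_mem : ∀ a ∈ U, ∀ t ∈ cube k, polyMap J a (map t) ∈ D
  coeff_mem : ∀ a ∈ U, ∀ t ∈ cube k, InLocalSystem g η (graphPt J a (map t)) (coeff a t)
  coeff_locallyConstant : ∀ a₀ ∈ U, ∀ t₀ ∈ cube k, ∀ᶠ y in 𝓝[U ×ˢ cube k] (a₀, t₀),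
    coeff y.1 y.2 =ᶠ[𝓝 (graphPt J y.1 (map y.2))] coeff a₀ t₀

theorem insertNth_mem_cube {k : ℕ} (q : Fin (k + 1)) {e : ℝ} (he : e ∈ Set.Icc (0 : ℝ) 1)
    {t : Fin k → ℝ} (ht : t ∈ cube k) : (q.insertNth e t : Fin (k + 1) → ℝ) ∈ cube (k + 1) := by
  constructor
  · intro r
    refine Fin.succAboveCases q ?_ (fun i => ?_) r
    · simpa using he.1
    · simpa using ht.1 i
  · intro r
    refine Fin.succAboveCases q ?_ (fun i => ?_) r
    · simpa using he.2
    · simpa using ht.2 i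

theorem contDiff_insertNth {k : ℕ} (q : Fin (k + 1)) (e : ℝ) :
    ContDiff ℝ (⊤ : ℕ∞) (fun t : Fin k → ℝ => (q.insertNth e t : Fin (k + 1) → ℝ)) := by
  rw [contDiff_pi]
  intro r
  refine Fin.succAboveCases q ?_ (fun i => ?_) r
  · simpa using contDiff_const
  · simpa using contDiff_apply ℝ ℝ i

section Chains

variable {M m n : ℕ} {J : Fin n → Finset (Fin M → ℕ)} {D : Set (Fin n → ℂ)}
  {E : Set (Fin M → ℂ)} {g : MultivaluedHol (F := ℂ) D} {η : MultivaluedHol (F := Form M m) E}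

/-- The face `t_q = e` of a loaded cube. -/
noncomputable def LoadedCube.face {U : Set (Idx J → ℂ)} {k : ℕ}
    (c : LoadedCube J g η U (k + 1)) (q : Fin (k + 1)) (e : ℝ) (he : e ∈ Set.Icc (0 : ℝ) 1) :
    LoadedCube J g η U k where
  map t := c.map (q.insertNth e t)
  coeff a t := c.coeff a (q.insertNth e t)
  smooth := c.smooth.comp (contDiff_insertNth q e)
  map_mem t ht := c.map_mem _ (insertNth_mem_cube q he ht)
  polyMap_mem a ha t ht := c.polyMap_mem a ha _ (insertNth_mem_cube q he ht)
  coeff_mem a ha t ht := c.coeff_mem a ha _ (insertNth_mem_cube q he ht)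
  coeff_locallyConstant a₀ ha₀ t₀ ht₀ := by
    have h := c.coeff_locallyConstant a₀ ha₀ _ (insertNth_mem_cube q he ht₀)
    have hc : Continuous (fun y : (Idx J → ℂ) × (Fin k → ℝ) =>
        (y.1, (q.insertNth e y.2 : Fin (k + 1) → ℝ))) :=
      continuous_fst.prodMk ((contDiff_insertNth q e).continuous.comp continuous_snd)
    have ht : Tendsto (fun y : (Idx J → ℂ) × (Fin k → ℝ) =>
        (y.1, (q.insertNth e y.2 : Fin (k + 1) → ℝ))) (𝓝[U ×ˢ cube k] (a₀, t₀))
        (𝓝[U ×ˢ cube (k + 1)] (a₀, q.insertNth e t₀)) :=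
      hc.continuousWithinAt.tendsto_nhdsWithin
        (fun y hy => ⟨hy.1, insertNth_mem_cube q he hy.2⟩)
    exact ht.eventually h

/-- Restriction of the parameter set. -/
def LoadedCube.restrict {U U' : Set (Idx J → ℂ)} (h : U' ⊆ U) {k : ℕ}
    (c : LoadedCube J g η U k) : LoadedCube J g η U' k where
  map := c.map
  coeff := c.coeff
  smooth := c.smooth
  map_mem := c.map_mem
  polyMap_mem a ha := c.polyMap_mem a (h ha)
  coeff_mem a ha := c.coeff_mem a (h ha)
  coeff_locallyConstant a₀ ha₀ t₀ ht₀ :=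
    (c.coeff_locallyConstant a₀ (h ha₀) t₀ ht₀).filter_mono
      (nhdsWithin_mono _ (Set.prod_mono_left h))

variable (J g η) in
/-- Formal linear combinations of loaded `k`-cubes. -/
abbrev PreChain (U : Set (Idx J → ℂ)) (k : ℕ) : Type := LoadedCube J g η U k →₀ ℂ

/-- On one and the same cube, the coefficient of `c` is `r₁` times that of `c₁` plus `r₂` times that
of `c₂`. -/
def IsLinearCombination {U : Set (Idx J → ℂ)} {k : ℕ} (c : LoadedCube J g η U k) (r₁ r₂ : ℂ)
    (c₁ c₂ : LoadedCube J g η U k) : Prop :=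
  ∀ t ∈ cube k, c₁.map t = c.map t ∧ c₂.map t = c.map t ∧
    ∀ a ∈ U, c.coeff a t =ᶠ[𝓝 (graphPt J a (c.map t))]
      fun y => r₁ • c₁.coeff a t y + r₂ • c₂.coeff a t y

/-- The cube does not depend on one of its coordinates. -/
def IsDegenerate {U : Set (Idx J → ℂ)} {k : ℕ} (c : LoadedCube J g η U k) : Prop :=
  ∃ q : Fin k, ∀ t ∈ cube k, ∀ e ∈ Set.Icc (0 : ℝ) 1, c.map (Function.update t q e) = c.map t

/-- `c` and `c'` are the same loaded cube in projective space: `c'.map = l • c.map` for a smooth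
nowhere vanishing function `l`, and the coefficient of `c` is the pullback of that of `c'`
under `(z, x) ↦ (l^d z, l x)`. -/
def IsRescaling (d : Fin n → ℕ) {U : Set (Idx J → ℂ)} {k : ℕ}
    (c c' : LoadedCube J g η U k) : Prop :=
  ∃ l : (Fin k → ℝ) → ℂ, ContDiff ℝ (⊤ : ℕ∞) l ∧ ∀ t ∈ cube k, l t ≠ 0 ∧ c'.map t = l t • c.map t ∧
    ∀ a ∈ U, c.coeff a t =ᶠ[𝓝 (graphPt J a (c.map t))]
      fun y => (l t) ^ m • c'.coeff a t (fun i => (l t) ^ d i * y.1 i, l t • y.2)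

/-- The formal combinations that represent the zero chain.  The quotient of `PreChain` by this
submodule is the group of normalized cubical singular chains with values in the local system, of
affine or of projective space: coefficients over the same cube are added, degenerate cubes are
zero, and in the projective case cubes in homogeneous coordinates that give the same cube
in `ℙᵐ` are identified. -/
noncomputable def zeroChains (X : Ambient) (d : Fin n → ℕ) (U : Set (Idx J → ℂ)) (k : ℕ) :
    Submodule ℂ (PreChain J g η U k) :=
  Submodule.span ℂ
    ({C | ∃ c c₁ c₂ r₁ r₂, IsLinearCombination c r₁ r₂ c₁ c₂ ∧
        C = Finsupp.single c 1 - Finsupp.single c₁ r₁ - Finsupp.single c₂ r₂} ∪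
      {C | ∃ c, IsDegenerate c ∧ C = Finsupp.single c 1} ∪
      {C | X = .projective ∧ ∃ c c', IsRescaling d c c' ∧
        C = Finsupp.single c 1 - Finsupp.single c' 1})

/-- The cubical boundary. -/
noncomputable def boundary {U : Set (Idx J → ℂ)} {k : ℕ} (C : PreChain J g η U (k + 1)) :
    PreChain J g η U k :=
  C.sum fun c r => ∑ q : Fin (k + 1), ((-1 : ℂ) ^ (q : ℕ) * r) •
    (Finsupp.single (c.face q 1 ⟨zero_le_one, le_rfl⟩) 1 -
      Finsupp.single (c.face q 0 ⟨le_rfl, zero_le_one⟩) 1)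

/-- Cycles with values in the local system. -/
def IsCycle (X : Ambient) (d : Fin n → ℕ) {U : Set (Idx J → ℂ)} :
    {k : ℕ} → PreChain J g η U k → Prop
  | 0, _ => True
  | _ + 1, C => boundary C ∈ zeroChains X d U _

/-- The integral over a loaded `m`-cube of its multivalued `m`-form `g(f_a(x)) η`. -/
noncomputable def LoadedCube.integral {U : Set (Idx J → ℂ)} (c : LoadedCube J g η U m)
    (a : Idx J → ℂ) : ℂ :=
  ∫ t in cube m, c.coeff a t (graphPt J a (c.map t))
    (fun q => fderiv ℝ c.map t (Pi.single q 1))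

/-- The period `∮_C g(f_a(x)) η`. -/
noncomputable def period {U : Set (Idx J → ℂ)} (C : PreChain J g η U m) (a : Idx J → ℂ) : ℂ :=
  C.sum fun c r => r * c.integral a

end Chains

/-- `Φ` is a holomorphic solution on the open set `U` of the `A`-hypergeometric system with
exponent `γ`, where `A` is a finite family of integer vectors `A k`, one for each variable `a_k`:
the homogeneity equations `∑_k (A k)_r a_k ∂Φ/∂a_k = γ_r Φ`, and the equations
`∂^q Φ / ∂a_{k_1} ⋯ ∂a_{k_q} = ∂^{q'} Φ / ∂a_{l_1} ⋯ ∂a_{l_{q'}}` whenever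
`A k_1 + ⋯ + A k_q = A l_1 + ⋯ + A l_{q'}`. -/
structure IsAHypergeometric {I R : Type*} [Fintype I] [DecidableEq I] (A : I → R → ℤ)
    (γ : R → ℂ) (U : Set (I → ℂ)) (Φ : (I → ℂ) → ℂ) : Prop where
  holomorphic : DifferentiableOn ℂ Φ U
  homogeneity : ∀ r, ∀ a ∈ U,
    ∑ k, (A k r : ℂ) * a k * fderiv ℂ Φ a (Pi.single k 1) = γ r * Φ a
  box : ∀ (q q' : ℕ) (k : Fin q → I) (l : Fin q' → I), ∑ s, A (k s) = ∑ s, A (l s) →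
    ∀ a ∈ U, iteratedFDeriv ℂ q Φ a (fun s => Pi.single (k s) 1) =
      iteratedFDeriv ℂ q' Φ a (fun s => Pi.single (l s) 1)

/-- The vectors `(e_i, j)` attached to the coefficients `a_{ij}`. -/
def exponentVectors {M n : ℕ} (J : Fin n → Finset (Fin M → ℕ)) :
    Idx J → Fin n ⊕ Fin M → ℤ :=
  fun k => Sum.elim (Pi.single k.1 1) (fun p => (k.2.1 p : ℤ))

end AHyp

/-! Let `θ` be the restriction of a section `s(z, x)` of the local system to the graph `z = f_a(x)`.
As `f_a(x)` is linear in `a`, the chain rule makes `∂/∂a_{ij}` act on the integrand as the operator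
`x^j ∂/∂z_i`. The cubes are compact and fixed, so one may differentiate under the integral
(`IsGermSection.hasFDerivAt_germIntegral`), and the period is holomorphic. The factor `x^j` does not
involve `z`, so a product of such operators depends only on the sum of the vectors `(e_i, j)`
(`HolAt.foldr_coeffDeriv_eq_of_sum_eq`): these are the box equations. The equations for the rows
`e_i` are `z_i ∂s/∂z_i = α_i s` under the integral, with `z_i = ∑_j a_{ij} x^j`. None of this uses
that the chain is a cycle.

For a row `p`, quasi-homogeneity gives `L_p θ = ∑ j_p a_{ij} x^j ∂s/∂z_i + β_p θ`, where `L_p` is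
the Lie derivative along `x_p ∂/∂x_p`, so it remains to show `∮ L_p θ = 0`. The form `θ` is closed
(`InLocalSystem.closed_restrict_graph`): in the affine case it has top degree, and in the projective
case `dθ` has top degree on `ℂ^(m+1)` and is killed by the Euler field. Cartan's formula then reads
`L_p θ = d(ι_p θ)`, and Stokes' formula on each cube (`LoadedCube.integral_lieDeriv`) reduces the
integral to that of `ι_p θ` over the boundary. The latter vanishes because every relation defining
the zero chains respects it (`contractedPeriod_eq_zero`).

For the extension of cycles, compactness gives function elements on balls of one radius around the
graph points of a cube, and these serve for all nearby `a` (`LoadedCube.exists_isContinuation`). By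
uniqueness of analytic continuation (`IsGermSection.eventuallyEq_of_isPreconnected`) relations
between cubes persist. The cycle condition involves finitely many relations, so one small ball of
coefficients suffices. -/

namespace AHyp

open MeasureTheory

/-! ### Integrals over compact sets depending on a parameter -/

section ParametricIntegral

variable {𝕜 P T F : Type*} [RCLike 𝕜] [NormedAddCommGroup P] [NormedSpace 𝕜 P]
  [LocallyCompactSpace P] [NormedAddCommGroup F] [NormedSpace ℝ F] [NormedSpace 𝕜 F]
  [TopologicalSpace T] [T2Space T] [MeasurableSpace T] [OpensMeasurableSpace T]

theorem continuousOn_section {A B C : Type*} [TopologicalSpace A] [TopologicalSpace B]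
    [TopologicalSpace C] {U : Set A} {K : Set B} {h : A → B → C}
    (hh : ContinuousOn (Function.uncurry h) (U ×ˢ K)) {a : A} (ha : a ∈ U) :
    ContinuousOn (h a) K :=
  hh.comp (Continuous.prodMk_right a).continuousOn (fun _ ht => ⟨ha, ht⟩)

/-- Continuity of an integral over a compact set in a parameter. -/
theorem continuousOn_setIntegral_of_continuousOn {μ : Measure T} [IsFiniteMeasureOnCompacts μ]
    {U : Set P} (hU : IsOpen U) {K : Set T} (hK : IsCompact K) {h : P → T → F}
    (hh : ContinuousOn (Function.uncurry h) (U ×ˢ K)) :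
    ContinuousOn (fun b => ∫ t in K, h b t ∂μ) U := by
  intro a ha
  -- On a compact neighbourhood of the parameter the integrand is bounded, and a constant is
  -- integrable over `K`.
  obtain ⟨V, hV, hVU, hVc⟩ := local_compact_nhds (hU.mem_nhds ha)
  obtain ⟨C, hC⟩ := (hVc.prod hK).exists_bound_of_continuousOn
    (hh.mono (Set.prod_mono_left hVU))
  have key : ContinuousOn (fun b => ∫ t in K, h b t ∂μ) V := by
    refine continuousOn_of_dominated (bound := fun _ => C)
      (fun b hb => (continuousOn_section hh (hVU hb)).aestronglyMeasurable_of_isCompact hK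
        hK.measurableSet) (fun b hb => ?_) ?_ ?_
    · exact (ae_restrict_iff' hK.measurableSet).2 (Eventually.of_forall fun t ht => hC (b, t) ⟨hb, ht⟩)
    · exact integrableOn_const (hK.measure_lt_top.ne)
    · refine (ae_restrict_iff' hK.measurableSet).2 (Eventually.of_forall fun t ht => ?_)
      exact hh.comp (Continuous.prodMk_left t).continuousOn (fun b hb => ⟨hVU hb, ht⟩)
  exact (key.continuousAt hV).continuousWithinAt

/-- Differentiation under the integral sign over a compact set. -/
theorem hasFDerivAt_setIntegral_of_continuousOn {μ : Measure T} [IsFiniteMeasureOnCompacts μ]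
    {U : Set P} (hU : IsOpen U) {K : Set T} (hK : IsCompact K)
    {h : P → T → F} {h' : P → T → P →L[𝕜] F}
    (hh : ContinuousOn (Function.uncurry h) (U ×ˢ K))
    (hh' : ContinuousOn (Function.uncurry h') (U ×ˢ K))
    (hd : ∀ a ∈ U, ∀ t ∈ K, HasFDerivAt (h · t) (h' a t) a) {a : P} (ha : a ∈ U) :
    HasFDerivAt (fun b => ∫ t in K, h b t ∂μ) (∫ t in K, h' a t ∂μ) a := by
  obtain ⟨V, hV, hVU, hVc⟩ := local_compact_nhds (hU.mem_nhds ha)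
  obtain ⟨C, hC⟩ := (hVc.prod hK).exists_bound_of_continuousOn
    (hh'.mono (Set.prod_mono_left hVU))
  refine hasFDerivAt_integral_of_dominated_of_fderiv_le (bound := fun _ => C) hV ?_ ?_ ?_ ?_ ?_ ?_
  · filter_upwards [hV] with b hb
    exact (continuousOn_section hh (hVU hb)).aestronglyMeasurable_of_isCompact hK hK.measurableSet
  · exact (continuousOn_section hh ha).integrableOn_compact hK
  · exact (continuousOn_section hh' ha).aestronglyMeasurable_of_isCompact hK hK.measurableSet
  · exact (ae_restrict_iff' hK.measurableSet).2
      (Eventually.of_forall fun t ht b hb => hC (b, t) ⟨hb, ht⟩)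
  · exact integrableOn_const (hK.measure_lt_top.ne)
  · exact (ae_restrict_iff' hK.measurableSet).2
      (Eventually.of_forall fun t ht b hb => hd b (hVU hb) t ht)

end ParametricIntegral

/-! ### Holomorphic functions of several complex variables -/

section SeveralVariables

variable {V F : Type*} [NormedAddCommGroup V] [NormedSpace ℂ V]
  [NormedAddCommGroup F] [NormedSpace ℂ F]

/-- The function element `f` is holomorphic at `y`. -/
def HolAt (f : V → F) (y : V) : Prop := ∀ᶠ y' in 𝓝 y, DifferentiableAt ℂ f y'

theorem HolAt.differentiableAt {f : V → F} {y : V} (h : HolAt f y) : DifferentiableAt ℂ f y :=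
  h.self_of_nhds

theorem HolAt.eventually {f : V → F} {y : V} (h : HolAt f y) : ∀ᶠ y' in 𝓝 y, HolAt f y' :=
  eventually_eventually_nhds.2 h

theorem HolAt.congr {f g : V → F} {y : V} (h : HolAt f y) (hfg : g =ᶠ[𝓝 y] f) : HolAt g y := by
  filter_upwards [h, hfg.eventuallyEq_nhds] with y' h1 h2
  exact h1.congr_of_eventuallyEq h2

theorem HolAt.add {f g : V → F} {y : V} (hf : HolAt f y) (hg : HolAt g y) :
    HolAt (fun y => f y + g y) y := by
  filter_upwards [hf, hg] with y' h1 h2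
  exact h1.add h2

theorem HolAt.smul {c : V → ℂ} {f : V → F} {y : V} (hc : HolAt c y) (hf : HolAt f y) :
    HolAt (fun y => c y • f y) y := by
  filter_upwards [hc, hf] with y' h1 h2
  exact h1.smul h2

theorem holAt_of_differentiable {f : V → F} (hf : Differentiable ℂ f) (y : V) : HolAt f y :=
  Eventually.of_forall fun _ => hf _

theorem HolAt.comp {W : Type*} [NormedAddCommGroup W] [NormedSpace ℂ W] {f : V → F} {k : W → V}
    {y : W} (hf : HolAt f (k y)) (hk : Differentiable ℂ k) : HolAt (fun y => f (k y)) y := by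
  filter_upwards [hk.continuous.continuousAt.eventually hf] with y' h1
  exact h1.comp y' (hk y')

theorem HolAt.exists_isOpen {f : V → F} {y : V} (h : HolAt f y) :
    ∃ U, IsOpen U ∧ y ∈ U ∧ DifferentiableOn ℂ f U := by
  obtain ⟨U, hU, hUo, hy⟩ := eventually_nhds_iff.1 h
  exact ⟨U, hUo, hy, fun z hz => (hU z hz).differentiableWithinAt⟩

variable [CompleteSpace F]

/-- Cauchy's formula for a directional derivative, on a ball of controlled radius. -/
theorem exists_fderiv_apply_eq_circleIntegral {U : Set V} (hU : IsOpen U) {f : V → F}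
    (hf : DifferentiableOn ℂ f U) {z₀ : V} (hz₀ : z₀ ∈ U) (v : V) :
    ∃ B : Set V, IsOpen B ∧ z₀ ∈ B ∧ B ⊆ U ∧ ∃ r : ℝ, 0 < r ∧
      (∀ z ∈ B, ∀ ζ ∈ Metric.closedBall (0 : ℂ) r, z + ζ • v ∈ U) ∧
      ∀ z ∈ B, fderiv ℂ f z v =
        (2 * Real.pi * Complex.I : ℂ)⁻¹ • ∮ ζ in C(0, r), (ζ ^ 2)⁻¹ • f (z + ζ • v) := by
  have hopen : IsOpen ((fun p : V × ℂ => p.1 + p.2 • v) ⁻¹' U) := hU.preimage (by fun_prop)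
  have hmem : (z₀, (0 : ℂ)) ∈ ((fun p : V × ℂ => p.1 + p.2 • v) ⁻¹' U) := by simpa using hz₀
  -- A product neighbourhood of `(z₀, 0)` provides one radius `r` valid for all `z ∈ B`.
  obtain ⟨B, W, hB, hW, hzB, hW0, hBW⟩ := isOpen_prod_iff.1 hopen _ _ hmem
  obtain ⟨r, hr, hrW⟩ := Metric.nhds_basis_closedBall.mem_iff.1 (hW.mem_nhds hW0)
  have hsub : ∀ z ∈ B, ∀ ζ ∈ W, z + ζ • v ∈ U := fun z hz ζ hζ =>
    hBW (Set.mk_mem_prod hz hζ)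
  have hBU : B ⊆ U := fun z hz => by simpa using hsub z hz 0 hW0
  refine ⟨B, hB, hzB, hBU, r, hr, fun z hz ζ hζ => hsub z hz ζ (hrW hζ), fun z hz => ?_⟩
  have hline : ∀ ζ : ℂ, HasDerivAt (fun ζ : ℂ => z + ζ • v) v ζ := fun ζ => by
    simpa using ((hasDerivAt_id ζ).smul_const v).const_add z
  have hd : DifferentiableOn ℂ (fun ζ : ℂ => f (z + ζ • v)) W := fun ζ hζ =>
    (((hf.differentiableAt (hU.mem_nhds (hsub z hz ζ hζ))).comp ζ
      (hline ζ).differentiableAt)).differentiableWithinAt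
  have h1 := Complex.two_pi_I_inv_smul_circleIntegral_sub_sq_inv_smul_of_differentiable hW hrW hd
    (Metric.mem_ball_self hr)
  simp only [sub_zero] at h1
  rw [h1]
  have h2 : HasFDerivAt f (fderiv ℂ f z) (z + (0 : ℂ) • v) := by
    simpa using (hf.differentiableAt (hU.mem_nhds (hBU hz))).hasFDerivAt
  exact (h2.comp_hasDerivAt (0 : ℂ) (hline 0)).deriv.symm

/-- The target `G` is arbitrary so that this applies both to `f` and to its derivative `fderiv ℂ f`,
as differentiation of the Cauchy integral requires. -/
theorem continuousOn_circle_integrand {A G : Type*} [TopologicalSpace A] [NormedAddCommGroup G]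
    [NormedSpace ℂ G] {v : V} {U : Set V} {B : Set A} {w : A → V} {r : ℝ}
    (hr : 0 < r) (hw : ContinuousOn w B)
    (hB : ∀ z ∈ B, ∀ ζ ∈ Metric.closedBall (0 : ℂ) r, w z + ζ • v ∈ U) {f : V → G}
    (hf : ContinuousOn f U) :
    ContinuousOn (Function.uncurry fun (z : A) (θ : ℝ) =>
      deriv (circleMap 0 r) θ • ((circleMap 0 r θ) ^ 2)⁻¹ • f (w z + circleMap 0 r θ • v))
      (B ×ˢ Set.Icc 0 (2 * Real.pi)) := by
  have hc : Continuous fun p : A × ℝ => circleMap 0 r p.2 :=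
    (continuous_circleMap 0 r).comp continuous_snd
  have hw' : ContinuousOn (fun p : A × ℝ => w p.1) (B ×ˢ Set.Icc 0 (2 * Real.pi)) :=
    hw.comp continuousOn_fst (fun p hp => hp.1)
  have hfw : ContinuousOn (fun p : A × ℝ => f (w p.1 + circleMap 0 r p.2 • v))
      (B ×ˢ Set.Icc 0 (2 * Real.pi)) := by
    refine hf.comp (hw'.add (hc.smul continuous_const).continuousOn) (fun p hp => ?_)
    exact hB _ hp.1 _ (by simp [abs_of_pos hr])
  have hinv : Continuous fun p : A × ℝ => ((circleMap 0 r p.2) ^ 2)⁻¹ :=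
    (hc.pow 2).inv₀ fun p => pow_ne_zero _ (circleMap_ne_center hr.ne')
  have hder : Continuous fun p : A × ℝ => deriv (circleMap 0 r) p.2 := by
    simp only [deriv_circleMap]
    exact hc.mul continuous_const
  exact hder.continuousOn.smul (hinv.continuousOn.smul hfw)

theorem circleIntegral_eq_setIntegral {G : Type*} [NormedAddCommGroup G] [NormedSpace ℂ G]
    (f : ℂ → G) (c : ℂ) (r : ℝ) :
    (∮ ζ in C(c, r), f ζ) =
      ∫ θ in Set.Icc 0 (2 * Real.pi), deriv (circleMap c r) θ • f (circleMap c r θ) := by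
  rw [circleIntegral, intervalIntegral.integral_of_le (by positivity), integral_Icc_eq_integral_Ioc]

/-- The identity theorem on convex open sets. -/
theorem eqOn_of_eventuallyEq_of_convex {S : Set V} (hS : IsOpen S) (hc : Convex ℝ S)
    {f g : V → F} (hf : DifferentiableOn ℂ f S) (hg : DifferentiableOn ℂ g S) {p : V} (hp : p ∈ S)
    (h : f =ᶠ[𝓝 p] g) : Set.EqOn f g S := by
  intro q hq
  -- Restriction to the complex line through `p` and `q` reduces the claim to one variable; the
  -- preimage of `S` is convex, hence connected.
  let L : ℂ → V := fun ζ => p + ζ • (q - p)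
  have hL : Differentiable ℂ L := by fun_prop
  have hLc : Continuous L := hL.continuous
  have hLo : IsOpen (L ⁻¹' S) := hS.preimage hLc
  have hconv : Convex ℝ (L ⁻¹' S) := by
    intro x hx y hy a b ha hb hab
    have : L (a • x + b • y) = a • L x + b • L y := by
      simp only [L, smul_add, add_smul, Complex.real_smul]
      have h1 : p = a • p + b • p := by rw [← add_smul, hab, one_smul]
      nth_rewrite 1 [h1]
      simp only [mul_smul, Complex.coe_smul]
      abel
    show L _ ∈ S
    rw [this]
    exact hc hx hy ha hb hab
  have h0 : (0 : ℂ) ∈ L ⁻¹' S := by simpa [L] using hp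
  have h1 : (1 : ℂ) ∈ L ⁻¹' S := by simpa [L] using hq
  have hd : ∀ {k : V → F}, DifferentiableOn ℂ k S → AnalyticOnNhd ℂ (k ∘ L) (L ⁻¹' S) :=
    fun hk => (hk.comp hL.differentiableOn fun _ hx => hx).analyticOnNhd hLo
  have hev : f ∘ L =ᶠ[𝓝 0] g ∘ L := by
    have : Tendsto L (𝓝 0) (𝓝 p) := by simpa [L] using hLc.tendsto 0
    exact this.eventually h
  have := (hd hf).eqOn_of_preconnected_of_eventuallyEq (hd hg) hconv.isPreconnected h0 hev h1
  simpa [L] using this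

variable [FiniteDimensional ℂ V]

/-- It is enough to treat one direction `v` at a time. There Cauchy's formula is a parameter
integral involving only the values of `f`, which are continuous. -/
theorem continuousOn_fderiv_of_differentiableOn {U : Set V} (hU : IsOpen U) {f : V → F}
    (hf : DifferentiableOn ℂ f U) : ContinuousOn (fderiv ℂ f) U := by
  have : ProperSpace V := FiniteDimensional.proper ℂ V
  rw [continuousOn_clm_apply]
  intro v z₀ hz₀
  obtain ⟨B, hB, hzB, hBU, r, hr, hsub, heq⟩ := exists_fderiv_apply_eq_circleIntegral hU hf hz₀ v
  have hcont := continuousOn_setIntegral_of_continuousOn (μ := volume) hB isCompact_Icc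
    (continuousOn_circle_integrand hr continuousOn_id hsub hf.continuousOn)
  refine ContinuousAt.continuousWithinAt (ContinuousOn.continuousAt (s := B) ?_ (hB.mem_nhds hzB))
  refine (hcont.const_smul (2 * Real.pi * Complex.I : ℂ)⁻¹).congr (fun z hz => ?_)
  rw [heq z hz, circleIntegral_eq_setIntegral]
  rfl

/-- Directional derivatives of a complex differentiable function are complex differentiable. -/
theorem differentiableOn_fderiv_apply {U : Set V} (hU : IsOpen U) {f : V → F}
    (hf : DifferentiableOn ℂ f U) (v : V) : DifferentiableOn ℂ (fun z => fderiv ℂ f z v) U := by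
  have : ProperSpace V := FiniteDimensional.proper ℂ V
  intro z₀ hz₀
  obtain ⟨B, hB, hzB, hBU, r, hr, hsub, heq⟩ := exists_fderiv_apply_eq_circleIntegral hU hf hz₀ v
  -- Cauchy's formula is differentiated under the integral; this needs the derivative of `f` to be
  -- continuous, as shown just before.
  have hder := hasFDerivAt_setIntegral_of_continuousOn (μ := volume) (𝕜 := ℂ) hB isCompact_Icc
    (continuousOn_circle_integrand hr continuousOn_id hsub hf.continuousOn)
    (continuousOn_circle_integrand hr continuousOn_id hsub
      (continuousOn_fderiv_of_differentiableOn hU hf)) (fun z hz θ hθ => ?_) hzB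
  · refine DifferentiableAt.differentiableWithinAt ?_
    refine (hder.differentiableAt.const_smul (2 * Real.pi * Complex.I : ℂ)⁻¹).congr_of_eventuallyEq ?_
    filter_upwards [hB.mem_nhds hzB] with z hz
    rw [heq z hz, circleIntegral_eq_setIntegral]
    rfl
  · have h1 : z + circleMap 0 r θ • v ∈ U := hsub z hz _ (by simp [abs_of_pos hr])
    have h2 := (hf.differentiableAt (hU.mem_nhds h1)).hasFDerivAt
    have h3 : HasFDerivAt (fun z => z + circleMap 0 r θ • v) (ContinuousLinearMap.id ℂ V) z :=
      (hasFDerivAt_id z).add_const _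
    exact ((h2.comp z h3).const_smul _).const_smul _

/-- A complex differentiable function of several variables is smooth. -/
theorem contDiffOn_of_differentiableOn {U : Set V} (hU : IsOpen U) (n : ℕ) {f : V → F}
    (hf : DifferentiableOn ℂ f U) : ContDiffOn ℂ n f U := by
  induction n generalizing f with
  | zero => exact contDiffOn_zero.2 hf.continuousOn
  | succ n ih =>
    rw [Nat.cast_succ, contDiffOn_succ_iff_fderiv_of_isOpen hU]
    exact ⟨hf, by simp, contDiffOn_clm_apply.2 fun v => ih (differentiableOn_fderiv_apply hU hf v)⟩

theorem HolAt.fderiv_apply {f : V → F} {y : V} (h : HolAt f y) (v : V) :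
    HolAt (fun y => fderiv ℂ f y v) y := by
  obtain ⟨U, hU, hy, hd⟩ := h.exists_isOpen
  filter_upwards [hU.mem_nhds hy] with z hz
  exact (differentiableOn_fderiv_apply hU hd v).differentiableAt (hU.mem_nhds hz)

theorem HolAt.contDiffAt {f : V → F} {y : V} (h : HolAt f y) (n : ℕ) : ContDiffAt ℂ n f y := by
  obtain ⟨U, hU, hy, hd⟩ := h.exists_isOpen
  exact (contDiffOn_of_differentiableOn hU n hd).contDiffAt (hU.mem_nhds hy)

/-- Directional derivatives of a holomorphic function commute. -/
theorem HolAt.fderiv_fderiv_comm {f : V → F} {y : V} (h : HolAt f y) (v w : V) :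
    fderiv ℂ (fun y => fderiv ℂ f y v) y w = fderiv ℂ (fun y => fderiv ℂ f y w) y v := by
  have h2 : ContDiffAt ℂ 2 f y := h.contDiffAt 2
  have hs : IsSymmSndFDerivAt ℂ f y := h2.isSymmSndFDerivAt (by simp)
  have hd : DifferentiableAt ℂ (fderiv ℂ f) y :=
    (h2.fderiv_right (m := 1) (by norm_num)).differentiableAt (by norm_num)
  have key : ∀ u, fderiv ℂ (fun y => fderiv ℂ f y u) y = (fderiv ℂ (fderiv ℂ f) y).flip u := by
    intro u
    ext w
    rw [fderiv_clm_apply hd (differentiableAt_const u)]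
    simp
  rw [key, key]
  exact hs.eq _ _

end SeveralVariables
end AHyp

namespace AHyp

/-! ### Sections of germs along a map and their analytic continuation -/

section GermSections

variable {P V F : Type*} [TopologicalSpace P] [NormedAddCommGroup V] [NormedSpace ℂ V]
  [NormedAddCommGroup F] [NormedSpace ℂ F]

/-- `σ` is a section over `S` of the pullback under `γ` of the sheaf of holomorphic functions,
each germ being given by a function element. -/
structure IsGermSection (S : Set P) (γ : P → V) (σ : P → V → F) : Prop where
  holAt : ∀ p ∈ S, HolAt (σ p) (γ p)
  locallyConstant : ∀ p₀ ∈ S, ∀ᶠ p in 𝓝[S] p₀, σ p =ᶠ[𝓝 (γ p)] σ p₀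

variable {S : Set P} {γ : P → V} {σ τ : P → V → F}

theorem IsGermSection.continuousOn_eval (h : IsGermSection S γ σ) (hγ : ContinuousOn γ S) :
    ContinuousOn (fun p => σ p (γ p)) S := by
  intro p₀ hp₀
  have h1 : ContinuousWithinAt (fun p => σ p₀ (γ p)) S p₀ :=
    (h.holAt p₀ hp₀).differentiableAt.continuousAt.comp_continuousWithinAt (hγ p₀ hp₀)
  exact h1.congr_of_eventuallyEq ((h.locallyConstant p₀ hp₀).mono fun p hp => hp.self_of_nhds) rfl

theorem IsGermSection.map {G : Type*} [NormedAddCommGroup G] [NormedSpace ℂ G]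
    (h : IsGermSection S γ σ) (T : (V → F) → V → G)
    (hT : ∀ f y, HolAt f y → HolAt (T f) y)
    (hT' : ∀ f₁ f₂ y, f₁ =ᶠ[𝓝 y] f₂ → T f₁ =ᶠ[𝓝 y] T f₂) :
    IsGermSection S γ (fun p => T (σ p)) where
  holAt p hp := hT _ _ (h.holAt p hp)
  locallyConstant p₀ hp₀ := (h.locallyConstant p₀ hp₀).mono fun _ hp => hT' _ _ _ hp

theorem IsGermSection.comp_param {P' : Type*} [TopologicalSpace P'] {S' : Set P'} {k : P' → P}
    (h : IsGermSection S γ σ) (hk : ContinuousOn k S') (hS : Set.MapsTo k S' S) :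
    IsGermSection S' (γ ∘ k) (σ ∘ k) where
  holAt _ hp := h.holAt _ (hS hp)
  locallyConstant p₀ hp₀ :=
    ((hk p₀ hp₀).tendsto_nhdsWithin hS).eventually (h.locallyConstant _ (hS hp₀))

/-- Used for the identification of two lifts of a projective cube, where `k` is `(z, x) ↦ (l^d z, l
x)` and `c` is a power of `l`. -/
theorem IsGermSection.comp_smul {W : Type*} [NormedAddCommGroup W] [NormedSpace ℂ W] {k : W → V}
    {δ : P → W} (h : IsGermSection S γ σ) (hk : Differentiable ℂ k) (c : ℂ)
    (hδ : ∀ p ∈ S, k (δ p) = γ p) : IsGermSection S δ (fun p y => c • σ p (k y)) where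
  holAt p hp := (holAt_of_differentiable (differentiable_const c) _).smul
    (HolAt.comp (by rw [hδ p hp]; exact h.holAt p hp) hk)
  locallyConstant p₀ hp₀ := by
    filter_upwards [h.locallyConstant p₀ hp₀, self_mem_nhdsWithin] with p hp hpS
    have h1 : Tendsto k (𝓝 (δ p)) (𝓝 (γ p)) := by
      rw [← hδ p hpS]; exact hk.continuous.continuousAt
    filter_upwards [h1.eventually hp] with y hy
    rw [hy]

theorem IsGermSection.linearCombination (h : IsGermSection S γ σ) (h' : IsGermSection S γ τ)
    (r s : ℂ) : IsGermSection S γ (fun p y => r • σ p y + s • τ p y) where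
  holAt p hp := ((holAt_of_differentiable (differentiable_const r) _).smul (h.holAt p hp)).add
    ((holAt_of_differentiable (differentiable_const s) _).smul (h'.holAt p hp))
  locallyConstant p₀ hp₀ := by
    filter_upwards [h.locallyConstant p₀ hp₀, h'.locallyConstant p₀ hp₀] with p hp hp'
    filter_upwards [hp, hp'] with y hy hy'
    rw [hy, hy']

/-- Uniqueness of analytic continuation. -/
theorem IsGermSection.eventuallyEq_of_isPreconnected [CompleteSpace F]
    (h : IsGermSection S γ σ) (h' : IsGermSection S γ τ) (hγ : ContinuousOn γ S)
    (hS : IsPreconnected S) {p₀ p : P} (hp₀ : p₀ ∈ S) (hp : p ∈ S)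
    (h0 : σ p₀ =ᶠ[𝓝 (γ p₀)] τ p₀) : σ p =ᶠ[𝓝 (γ p)] τ p := by
  have : PreconnectedSpace S := isPreconnected_iff_preconnectedSpace.1 hS
  -- The truth value of "the two germs agree" is locally constant, hence constant on a preconnected
  -- set.
  have hlc : IsLocallyConstant fun q : S => (σ q =ᶠ[𝓝 (γ q)] τ q : Prop) := by
    rw [IsLocallyConstant.iff_eventually_eq]
    rintro ⟨q, hq⟩
    obtain ⟨r, hr, hball⟩ := Metric.eventually_nhds_iff_ball.1 ((h.holAt q hq).and (h'.holAt q hq))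
    have h1 : ∀ᶠ p in 𝓝[S] q, σ p =ᶠ[𝓝 (γ p)] σ q ∧ τ p =ᶠ[𝓝 (γ p)] τ q ∧
        γ p ∈ Metric.ball (γ q) r :=
      (h.locallyConstant q hq).and ((h'.locallyConstant q hq).and
        ((hγ q hq).eventually (Metric.ball_mem_nhds _ hr)))
    have h2 := (continuous_subtype_val.continuousWithinAt.tendsto_nhdsWithin
      (s := Set.univ) (x := (⟨q, hq⟩ : S)) (t := S) (fun x _ => x.2)).eventually h1
    rw [nhdsWithin_univ] at h2
    filter_upwards [h2] with p ⟨hp1, hp2, hp3⟩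
    have hfd : DifferentiableOn ℂ (σ q) (Metric.ball (γ q) r) := fun y hy =>
      (hball y hy).1.differentiableWithinAt
    have hgd : DifferentiableOn ℂ (τ q) (Metric.ball (γ q) r) := fun y hy =>
      (hball y hy).2.differentiableWithinAt
    -- Both function elements at `q` are holomorphic on one ball, so agreement of their germs at one
    -- point of it forces agreement at every other.
    have key : ∀ y₁ ∈ Metric.ball (γ q) r, ∀ y₂ ∈ Metric.ball (γ q) r, σ q =ᶠ[𝓝 y₁] τ q →
        σ q =ᶠ[𝓝 y₂] τ q := fun y₁ hy₁ y₂ hy₂ heq =>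
      (eqOn_of_eventuallyEq_of_convex Metric.isOpen_ball (convex_ball _ _) hfd hgd hy₁
        heq).eventuallyEq_of_mem (Metric.isOpen_ball.mem_nhds hy₂)
    refine propext ⟨fun heq => ?_, fun heq => ?_⟩
    · exact key _ hp3 _ (Metric.mem_ball_self hr) ((hp1.symm.trans heq).trans hp2)
    · exact (hp1.trans (key _ (Metric.mem_ball_self hr) _ hp3 heq)).trans hp2.symm
  have := hlc.apply_eq_of_preconnectedSpace ⟨p₀, hp₀⟩ ⟨p, hp⟩
  exact this.mp h0

end GermSections

/-! ### Stalks of the local system: holomorphy and quasi-homogeneity -/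

section LocalSystem

theorem MultivaluedHol.IsBranch.holAt {V F : Type*} [NormedAddCommGroup V] [NormedSpace ℂ V]
    [NormedAddCommGroup F] [NormedSpace ℂ F] {D : Set V} (g : MultivaluedHol (F := F) D) {z : V}
    (hz : z ∈ D) {b : V → F} (hb : g.IsBranch z b) :
    HolAt b z ∧ ∀ᶠ z' in 𝓝 z, g.IsBranch z' b := by
  obtain ⟨B, hB, hzB, -, S, hS, hbr⟩ := g.locallyConstant z hz
  obtain ⟨s, hs, hbs⟩ := (hbr z hzB b).1 hb
  constructor
  · refine HolAt.congr ?_ hbs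
    filter_upwards [hB.mem_nhds hzB] with y hy
    exact (hS s hs).differentiableAt (hB.mem_nhds hy)
  · filter_upwards [hB.mem_nhds hzB, hbs.eventuallyEq_nhds] with y hy hys
    exact (hbr y hy b).2 ⟨s, hs, hys⟩

theorem MultivaluedHol.isOpen {V F : Type*} [NormedAddCommGroup V] [NormedSpace ℂ V]
    [NormedAddCommGroup F] [NormedSpace ℂ F] {D : Set V} (g : MultivaluedHol (F := F) D) :
    IsOpen D := by
  rw [isOpen_iff_mem_nhds]
  intro z hz
  obtain ⟨B, hB, hzB, hBD, -⟩ := g.locallyConstant z hz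
  exact mem_of_superset (hB.mem_nhds hzB) hBD

variable {M m n : ℕ} {D : Set (Fin n → ℂ)} {E : Set (Fin M → ℂ)} {g : MultivaluedHol (F := ℂ) D}
  {η : MultivaluedHol (F := Form M m) E} {y : (Fin n → ℂ) × (Fin M → ℂ)}
  {s : (Fin n → ℂ) × (Fin M → ℂ) → Form M m}

theorem InLocalSystem.congr {s' : (Fin n → ℂ) × (Fin M → ℂ) → Form M m}
    (h : InLocalSystem g η y s) (hs : s' =ᶠ[𝓝 y] s) : InLocalSystem g η y s' := by
  obtain ⟨K, hK, hsK⟩ := h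
  exact ⟨K, hK, hs.trans hsK⟩

/-- Reduces a property of the stalk that is linear and depends only on germs to products of a branch
of `g` and a branch of `η`. -/
theorem InLocalSystem.induction {Q : ((Fin n → ℂ) × (Fin M → ℂ) → Form M m) → Prop}
    (h : InLocalSystem g η y s) (congr : ∀ s K, s =ᶠ[𝓝 y] K → Q K → Q s)
    (mem : ∀ b w, g.IsBranch y.1 b → η.IsBranch y.2 w → Q fun y' => b y'.1 • w y'.2)
    (zero : Q 0) (add : ∀ K₁ K₂, Q K₁ → Q K₂ → Q (K₁ + K₂))
    (smul : ∀ (c : ℂ) K, Q K → Q (c • K)) : Q s := by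
  obtain ⟨K, hK, hsK⟩ := h
  refine congr s K hsK (Submodule.span_induction (p := fun K _ => Q K) ?_ zero
    (fun _ _ _ _ h₁ h₂ => add _ _ h₁ h₂) (fun c _ _ h => smul c _ h) hK)
  rintro K ⟨b, w, hb, hw, rfl⟩
  exact mem b w hb hw

theorem InLocalSystem.holAt (h : InLocalSystem g η y s) (h1 : y.1 ∈ D) (h2 : y.2 ∈ E) :
    HolAt s y := by
  refine h.induction (Q := fun s => HolAt s y) (fun s K hs hK => hK.congr hs)
    (fun b w hb hw => ?_) (holAt_of_differentiable (differentiable_const 0) y) (fun _ _ h₁ h₂ => h₁.add h₂)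
    (fun c _ h => (holAt_of_differentiable (differentiable_const c) y).smul h)
  exact ((MultivaluedHol.IsBranch.holAt g h1 hb).1.comp differentiable_fst).smul
    ((MultivaluedHol.IsBranch.holAt η h2 hw).1.comp differentiable_snd)

theorem InLocalSystem.eventually (h : InLocalSystem g η y s) (h1 : y.1 ∈ D) (h2 : y.2 ∈ E) :
    ∀ᶠ y' in 𝓝 y, InLocalSystem g η y' s := by
  refine h.induction (Q := fun s => ∀ᶠ y' in 𝓝 y, InLocalSystem g η y' s)
    (fun s K hs hK => ?_) (fun b w hb hw => ?_) ?_ (fun _ _ h₁ h₂ => ?_) (fun c _ h => ?_)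
  · filter_upwards [hK, hs.eventuallyEq_nhds] with y' h1 h2
    exact h1.congr h2
  · filter_upwards [continuousAt_fst.eventually (MultivaluedHol.IsBranch.holAt g h1 hb).2,
      continuousAt_snd.eventually (MultivaluedHol.IsBranch.holAt η h2 hw).2] with y' hb' hw'
    exact ⟨_, Submodule.subset_span ⟨b, w, hb', hw', rfl⟩, EventuallyEq.rfl⟩
  · exact Eventually.of_forall fun y' => ⟨0, Submodule.zero_mem _, EventuallyEq.rfl⟩
  · filter_upwards [h₁, h₂] with y' ⟨K₁, hK₁, e₁⟩ ⟨K₂, hK₂, e₂⟩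
    exact ⟨K₁ + K₂, Submodule.add_mem _ hK₁ hK₂, e₁.add e₂⟩
  · filter_upwards [h] with y' ⟨K, hK, e⟩
    exact ⟨c • K, Submodule.smul_mem _ c hK, e.const_smul c⟩

theorem hasFDerivAt_mul_branch {b : (Fin n → ℂ) → ℂ} {w : (Fin M → ℂ) → Form M m}
    (hb : DifferentiableAt ℂ b y.1) (hw : DifferentiableAt ℂ w y.2) :
    HasFDerivAt (fun y' : (Fin n → ℂ) × (Fin M → ℂ) => b y'.1 • w y'.2)
      (b y.1 • (fderiv ℂ w y.2).comp (ContinuousLinearMap.snd ℂ _ _) +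
        ((fderiv ℂ b y.1).comp (ContinuousLinearMap.fst ℂ _ _)).smulRight (w y.2)) y :=
  (hb.hasFDerivAt.comp y hasFDerivAt_fst).smul (hw.hasFDerivAt.comp y hasFDerivAt_snd)

/-- On a product `b(z) w(x)` the derivative in `z_i` only meets `b`, and the equation is linear in
`s`. Differentiability is carried along in the induction because `fderiv` is additive only on
differentiable functions. -/
theorem InLocalSystem.quasiHomogeneous_fst {α : Fin n → ℂ} (hg : QuasiHomogeneousFun g α)
    (h : InLocalSystem g η y s) (h1 : y.1 ∈ D) (h2 : y.2 ∈ E) (i : Fin n)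
    (u : Fin m → Fin M → ℂ) :
    y.1 i * fderiv ℂ s y (Pi.single i 1, 0) u = α i * s y u := by
  refine (h.induction (Q := fun s => DifferentiableAt ℂ s y ∧
    y.1 i * fderiv ℂ s y (Pi.single i 1, 0) u = α i * s y u)
    (fun s K hs hK => ?_) (fun b w hb hw => ?_) ?_ (fun _ _ h₁ h₂ => ?_) (fun c _ h => ?_)).2
  · exact ⟨hK.1.congr_of_eventuallyEq hs, by rw [hs.fderiv_eq, hs.self_of_nhds, hK.2]⟩
  · have hd := hasFDerivAt_mul_branch (MultivaluedHol.IsBranch.holAt g h1 hb).1.differentiableAt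
      (MultivaluedHol.IsBranch.holAt η h2 hw).1.differentiableAt
    refine ⟨hd.differentiableAt, ?_⟩
    rw [hd.fderiv]
    simp only [add_apply, smul_apply, ContinuousLinearMap.comp_apply,
      ContinuousLinearMap.smulRight_apply, ContinuousLinearMap.coe_snd',
      ContinuousLinearMap.coe_fst', map_zero, ContinuousAlternatingMap.add_apply,
      ContinuousAlternatingMap.smul_apply, smul_eq_mul]
    have h0 : (0 : Form M m) u = 0 := rfl
    linear_combination w y.2 u * hg y.1 h1 b hb i + y.1 i * b y.1 * h0
  · exact ⟨differentiableAt_const 0, by simp⟩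
  · refine ⟨h₁.1.add h₂.1, ?_⟩
    rw [fderiv_add h₁.1 h₂.1]
    simp only [add_apply, ContinuousAlternatingMap.add_apply, Pi.add_apply]
    linear_combination h₁.2 + h₂.2
  · refine ⟨h.1.const_smul c, ?_⟩
    rw [fderiv_const_smul h.1]
    simp only [smul_apply, ContinuousAlternatingMap.smul_apply, Pi.smul_apply, smul_eq_mul]
    linear_combination c * h.2

theorem InLocalSystem.quasiHomogeneous_snd {β : Fin M → ℂ} (hη : QuasiHomogeneousForm η β)
    (h : InLocalSystem g η y s) (h1 : y.1 ∈ D) (h2 : y.2 ∈ E) (p : Fin M)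
    (u : Fin m → Fin M → ℂ) :
    fderiv ℂ s y (0, Pi.single p (y.2 p)) u
      + ∑ q, s y (Function.update u q (Pi.single p (u q p))) = β p * s y u := by
  refine (h.induction (Q := fun s => DifferentiableAt ℂ s y ∧
    fderiv ℂ s y (0, Pi.single p (y.2 p)) u
      + ∑ q, s y (Function.update u q (Pi.single p (u q p))) = β p * s y u)
    (fun s K hs hK => ?_) (fun b w hb hw => ?_) ?_ (fun _ _ h₁ h₂ => ?_) (fun c _ h => ?_)).2
  · exact ⟨hK.1.congr_of_eventuallyEq hs, by rw [hs.fderiv_eq, hs.self_of_nhds, hK.2]⟩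
  · have hd := hasFDerivAt_mul_branch (MultivaluedHol.IsBranch.holAt g h1 hb).1.differentiableAt
      (MultivaluedHol.IsBranch.holAt η h2 hw).1.differentiableAt
    refine ⟨hd.differentiableAt, ?_⟩
    rw [hd.fderiv]
    have := hη y.2 h2 w hw p u
    rw [lieDeriv] at this
    simp only [add_apply, smul_apply,
      ContinuousLinearMap.comp_apply, ContinuousLinearMap.smulRight_apply,
      ContinuousLinearMap.coe_snd', ContinuousLinearMap.coe_fst', map_zero, zero_smul, add_zero,
      ContinuousAlternatingMap.smul_apply, ← Finset.smul_sum, ← smul_add, this]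
    simp only [smul_eq_mul]
    ring
  · exact ⟨differentiableAt_const 0, by simp⟩
  · refine ⟨h₁.1.add h₂.1, ?_⟩
    rw [fderiv_add h₁.1 h₂.1]
    simp only [add_apply, ContinuousAlternatingMap.add_apply, Pi.add_apply,
      Finset.sum_add_distrib, mul_add, ← h₁.2, ← h₂.2]
    ring
  · refine ⟨h.1.const_smul c, ?_⟩
    rw [fderiv_const_smul h.1]
    simp only [smul_apply, ContinuousAlternatingMap.smul_apply, Pi.smul_apply,
      ← Finset.smul_sum, ← smul_add, h.2]
    simp only [smul_eq_mul]
    ring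

theorem InLocalSystem.map_eq_zero_of_eq_snd {J : Fin n → Finset (Fin M → ℕ)} {d : Fin n → ℕ}
    {α : Fin n → ℂ} {β : Fin M → ℂ} (hX : DescendsToProjective J d η α β)
    (h : InLocalSystem g η y s) (h2 : y.2 ∈ E) (u : Fin m → Fin M → ℂ) (q : Fin m)
    (hu : u q = y.2) : s y u = 0 := by
  refine h.induction (Q := fun s => s y u = 0)
    (fun s K hs hK => by rw [hs.self_of_nhds, hK]) (fun b w hb hw => ?_) rfl
    (fun _ _ h₁ h₂ => by simp [h₁, h₂]) (fun c _ h => by simp [h])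
  simp [hX.contraction y.2 h2 w hw u q hu]

end LocalSystem
end AHyp

namespace AHyp

open MeasureTheory

/-! ### The operators `x^j ∂/∂z_i` and the box relations -/

section CoefficientDerivatives

variable {M n : ℕ} {J : Fin n → Finset (Fin M → ℕ)} {F : Type*} [NormedAddCommGroup F]
  [NormedSpace ℂ F]

/-- The monomial `x^j`. -/
noncomputable def monomialAt (j : Fin M → ℕ) (x : Fin M → ℂ) : ℂ := ∏ p, x p ^ j p

theorem differentiable_monomialAt (j : Fin M → ℕ) : Differentiable ℂ (monomialAt j) := by
  unfold monomialAt
  fun_prop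

/-- The partial derivative `∂/∂z_i` of a function of `(z, x)`. -/
noncomputable def zDeriv (i : Fin n) (s : (Fin n → ℂ) × (Fin M → ℂ) → F) :
    (Fin n → ℂ) × (Fin M → ℂ) → F :=
  fun y => fderiv ℂ s y (Pi.single i 1, 0)

/-- The operator `x^j ∂/∂z_i`, by which `∂/∂a_{ij}` acts on functions of `(f_a(x), x)`. -/
noncomputable def coeffDeriv (k : Idx J) (s : (Fin n → ℂ) × (Fin M → ℂ) → F) :
    (Fin n → ℂ) × (Fin M → ℂ) → F :=
  fun y => monomialAt k.2.1 y.2 • zDeriv k.1 s y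

theorem zDeriv_congr {i : Fin n} {s₁ s₂ : (Fin n → ℂ) × (Fin M → ℂ) → F}
    {y : (Fin n → ℂ) × (Fin M → ℂ)} (h : s₁ =ᶠ[𝓝 y] s₂) : zDeriv i s₁ =ᶠ[𝓝 y] zDeriv i s₂ := by
  filter_upwards [h.fderiv (𝕜 := ℂ)] with y' hy'
  simp only [zDeriv, hy']

theorem coeffDeriv_congr {k : Idx J} {s₁ s₂ : (Fin n → ℂ) × (Fin M → ℂ) → F}
    {y : (Fin n → ℂ) × (Fin M → ℂ)} (h : s₁ =ᶠ[𝓝 y] s₂) :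
    coeffDeriv k s₁ =ᶠ[𝓝 y] coeffDeriv k s₂ := by
  filter_upwards [zDeriv_congr (i := k.1) h] with y' hy'
  simp only [coeffDeriv, hy']

theorem polyMap_eq_sum (a : Idx J → ℂ) (x : Fin M → ℂ) :
    polyMap J a x = ∑ k : Idx J, (a k * monomialAt k.2.1 x) • (Pi.single k.1 1 : Fin n → ℂ) := by
  ext i
  rw [Finset.sum_apply, Fintype.sum_sigma, Finset.sum_eq_single i]
  · simp [polyMap, monomialAt]
  · intro i' _ hi'
    simp [Pi.single_eq_of_ne hi'.symm]
  · simp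

theorem continuous_graphPt :
    Continuous fun p : (Idx J → ℂ) × (Fin M → ℂ) => graphPt J p.1 p.2 := by
  unfold graphPt polyMap
  fun_prop

theorem differentiable_graphPt (a : Idx J → ℂ) : Differentiable ℂ (graphPt J a) := by
  unfold graphPt polyMap
  fun_prop

theorem hasFDerivAt_graphPt_coeff (a : Idx J → ℂ) (x : Fin M → ℂ) :
    HasFDerivAt (fun a => graphPt J a x)
      (∑ k : Idx J, (ContinuousLinearMap.proj k : (Idx J → ℂ) →L[ℂ] ℂ).smulRight
        (monomialAt k.2.1 x • ((Pi.single k.1 1 : Fin n → ℂ), (0 : Fin M → ℂ)))) a := by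
  have h : (fun a => graphPt J a x) = fun a => (∑ k : Idx J,
      (ContinuousLinearMap.proj k : (Idx J → ℂ) →L[ℂ] ℂ).smulRight
        (monomialAt k.2.1 x • ((Pi.single k.1 1 : Fin n → ℂ), (0 : Fin M → ℂ)))) a + (0, x) := by
    funext a
    rw [graphPt, polyMap_eq_sum]
    refine Prod.ext ?_ ?_
    · simp [Prod.fst_sum, smul_smul]
    · simp [Prod.snd_sum]
  rw [h]
  exact (ContinuousLinearMap.hasFDerivAt _).add_const _

/-- Chain rule: for fixed `x` the point `(f_a(x), x)` is affine in `a`, and the coefficient `a_{ij}`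
moves it in the direction `x^j e_i`. -/
theorem HolAt.hasFDerivAt_comp_graphPt {s : (Fin n → ℂ) × (Fin M → ℂ) → F} {a : Idx J → ℂ}
    {x : Fin M → ℂ} (hs : HolAt s (graphPt J a x)) :
    HasFDerivAt (fun a => s (graphPt J a x))
      (∑ k : Idx J, (ContinuousLinearMap.proj k : (Idx J → ℂ) →L[ℂ] ℂ).smulRight
        (coeffDeriv k s (graphPt J a x))) a := by
  refine (hs.differentiableAt.hasFDerivAt.comp a (hasFDerivAt_graphPt_coeff a x)).congr_fderiv ?_
  ext b
  simp only [ContinuousLinearMap.comp_apply, sum_apply, map_sum,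
    ContinuousLinearMap.smulRight_apply, ContinuousLinearMap.map_smul]
  rfl

variable [CompleteSpace F]

theorem HolAt.zDeriv {s : (Fin n → ℂ) × (Fin M → ℂ) → F} {y : (Fin n → ℂ) × (Fin M → ℂ)}
    (h : HolAt s y) (i : Fin n) : HolAt (zDeriv i s) y :=
  h.fderiv_apply _

theorem HolAt.coeffDeriv {s : (Fin n → ℂ) × (Fin M → ℂ) → F} {y : (Fin n → ℂ) × (Fin M → ℂ)}
    (h : HolAt s y) (k : Idx J) : HolAt (coeffDeriv k s) y :=
  ((holAt_of_differentiable (differentiable_monomialAt k.2.1) y.2).comp differentiable_snd).smul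
    (h.zDeriv k.1)

theorem HolAt.foldr_coeffDeriv {s : (Fin n → ℂ) × (Fin M → ℂ) → F}
    {y : (Fin n → ℂ) × (Fin M → ℂ)} (h : HolAt s y) (l : List (Idx J)) :
    HolAt (l.foldr AHyp.coeffDeriv s) y := by
  induction l with
  | nil => exact h
  | cons k l ih => exact ih.coeffDeriv k

theorem HolAt.foldr_zDeriv {s : (Fin n → ℂ) × (Fin M → ℂ) → F}
    {y : (Fin n → ℂ) × (Fin M → ℂ)} (h : HolAt s y) (l : List (Fin n)) :
    HolAt (l.foldr AHyp.zDeriv s) y := by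
  induction l with
  | nil => exact h
  | cons k l ih => exact ih.zDeriv k

omit [CompleteSpace F] in
theorem foldr_coeffDeriv_congr {s₁ s₂ : (Fin n → ℂ) × (Fin M → ℂ) → F}
    {y : (Fin n → ℂ) × (Fin M → ℂ)} (h : s₁ =ᶠ[𝓝 y] s₂) (l : List (Idx J)) :
    l.foldr coeffDeriv s₁ =ᶠ[𝓝 y] l.foldr coeffDeriv s₂ := by
  induction l with
  | nil => exact h
  | cons k l ih => exact coeffDeriv_congr ih

theorem HolAt.foldr_zDeriv_perm {s : (Fin n → ℂ) × (Fin M → ℂ) → F}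
    {y : (Fin n → ℂ) × (Fin M → ℂ)} (h : HolAt s y) {l₁ l₂ : List (Fin n)} (hl : l₁.Perm l₂) :
    l₁.foldr AHyp.zDeriv s =ᶠ[𝓝 y] l₂.foldr AHyp.zDeriv s := by
  induction hl with
  | nil => rfl
  | cons i _ ih => exact zDeriv_congr ih
  | swap i j l =>
    filter_upwards [(h.foldr_zDeriv l).eventually] with y' hy'
    exact hy'.fderiv_fderiv_comm _ _
  | trans _ _ ih₁ ih₂ => exact ih₁.trans ih₂

/-- Monomials in `x` are constant in the directions `z_i`, so they can be pulled in front of all the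
derivatives, where their exponents add. -/
theorem HolAt.foldr_coeffDeriv_eq {s : (Fin n → ℂ) × (Fin M → ℂ) → F}
    {y : (Fin n → ℂ) × (Fin M → ℂ)} (h : HolAt s y) (l : List (Idx J)) :
    l.foldr AHyp.coeffDeriv s =ᶠ[𝓝 y] fun y => monomialAt (l.map fun k => k.2.1).sum y.2 •
      (l.map Sigma.fst).foldr AHyp.zDeriv s y := by
  induction l with
  | nil => exact Eventually.of_forall fun y => by simp [monomialAt]
  | cons k l ih =>
    refine (coeffDeriv_congr ih).trans ?_
    filter_upwards [(h.foldr_zDeriv (l.map Sigma.fst)).eventually] with y' hy'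
    have h1 : HasFDerivAt (fun y : (Fin n → ℂ) × (Fin M → ℂ) =>
        monomialAt (l.map fun k => k.2.1).sum y.2) _ y' :=
      ((differentiable_monomialAt _) y'.2).hasFDerivAt.comp y' hasFDerivAt_snd
    simp only [AHyp.coeffDeriv, AHyp.zDeriv, List.foldr_cons, List.map_cons, List.sum_cons]
    rw [(h1.fun_smul hy'.differentiableAt.hasFDerivAt).fderiv]
    simp [smul_smul, monomialAt, pow_add, Finset.prod_mul_distrib]

/-- The `r`-th entry of the sum counts the occurrences of `r` in the list. -/
theorem perm_of_sum_single_eq {l₁ l₂ : List (Fin n)}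
    (h : (l₁.map fun i => (Pi.single i 1 : Fin n → ℤ)).sum =
      (l₂.map fun i => (Pi.single i 1 : Fin n → ℤ)).sum) : l₁.Perm l₂ := by
  have key : ∀ (l : List (Fin n)) (r : Fin n),
      (l.map fun i => (Pi.single i 1 : Fin n → ℤ)).sum r = l.count r := by
    intro l r
    induction l with
    | nil => simp
    | cons i l ih =>
      rw [List.map_cons, List.sum_cons, Pi.add_apply, ih, List.count_cons]
      by_cases hir : i = r
      · subst hir; simp [add_comm]
      · simp [hir]
  rw [List.perm_iff_count]
  intro r
  have := congrFun h r
  rw [key, key] at this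
  exact_mod_cast this

/-- Products of the operators `x^j ∂/∂z_i` depend only on the sum of the vectors `(e_i, j)`. -/
theorem HolAt.foldr_coeffDeriv_eq_of_sum_eq {s : (Fin n → ℂ) × (Fin M → ℂ) → F}
    {y : (Fin n → ℂ) × (Fin M → ℂ)} (h : HolAt s y) {l₁ l₂ : List (Idx J)}
    (hl : (l₁.map (exponentVectors J)).sum = (l₂.map (exponentVectors J)).sum) :
    l₁.foldr AHyp.coeffDeriv s y = l₂.foldr AHyp.coeffDeriv s y := by
  have hfst : ∀ l : List (Idx J), (fun i => (l.map (exponentVectors J)).sum (Sum.inl i)) =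
      ((l.map Sigma.fst).map fun i => (Pi.single i 1 : Fin n → ℤ)).sum := by
    intro l
    induction l with
    | nil => rfl
    | cons k l ih => simp only [List.map_cons, List.sum_cons, ← ih]; rfl
  have hsnd : ∀ (l : List (Idx J)) (p : Fin M), (l.map (exponentVectors J)).sum (Sum.inr p) =
      (((l.map fun k => k.2.1).sum p : ℕ) : ℤ) := by
    intro l p
    induction l with
    | nil => rfl
    | cons k l ih =>
      simp only [List.map_cons, List.sum_cons, Pi.add_apply, ih, Nat.cast_add]; rfl
  have h1 : (l₁.map Sigma.fst).Perm (l₂.map Sigma.fst) := by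
    refine perm_of_sum_single_eq ?_
    rw [← hfst, ← hfst, hl]
  have h2 : (l₁.map fun k => k.2.1).sum = (l₂.map fun k => k.2.1).sum := by
    funext p
    have := hsnd l₁ p
    rw [hl, hsnd l₂ p] at this
    exact_mod_cast this.symm
  rw [(h.foldr_coeffDeriv_eq l₁).self_of_nhds, (h.foldr_coeffDeriv_eq l₂).self_of_nhds, h2]
  simp only [(h.foldr_zDeriv_perm h1).self_of_nhds]

end CoefficientDerivatives
end AHyp

namespace AHyp

open MeasureTheory

/-! ### Integrals of sections of germs over a cube -/

section Integrals

variable {M m n : ℕ} {J : Fin n → Finset (Fin M → ℕ)}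

/-- The integral over the cube `φ` of the form that at `φ t` is given by the germ `σ (a, t)`. -/
noncomputable def germIntegral (φ : (Fin m → ℝ) → Fin M → ℂ)
    (σ : (Idx J → ℂ) × (Fin m → ℝ) → (Fin n → ℂ) × (Fin M → ℂ) → Form M m) (a : Idx J → ℂ) : ℂ :=
  ∫ t in cube m, σ (a, t) (graphPt J a (φ t)) fun q => fderiv ℝ φ t (Pi.single q 1)

theorem continuousOn_graphPt_cube {k : ℕ} {φ : (Fin k → ℝ) → Fin M → ℂ} (hφ : Continuous φ)
    (S : Set ((Idx J → ℂ) × (Fin k → ℝ))) :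
    ContinuousOn (fun p : (Idx J → ℂ) × (Fin k → ℝ) => graphPt J p.1 (φ p.2)) S :=
  (continuous_graphPt.comp
    (continuous_fst.prodMk (hφ.comp continuous_snd))).continuousOn

theorem continuous_fderiv_single {k : ℕ} {φ : (Fin k → ℝ) → Fin M → ℂ}
    (hφ : ContDiff ℝ (⊤ : ℕ∞) φ) (q : Fin k) :
    Continuous fun t => fderiv ℝ φ t (Pi.single q 1) :=
  (hφ.continuous_fderiv (by simp)).clm_apply continuous_const

theorem IsGermSection.continuousOn_integrand {k : ℕ} {φ : (Fin k → ℝ) → Fin M → ℂ}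
    (hφ : Continuous φ) {u : (Fin k → ℝ) → Fin m → Fin M → ℂ} (hu : Continuous u)
    {U : Set (Idx J → ℂ)}
    {σ : (Idx J → ℂ) × (Fin k → ℝ) → (Fin n → ℂ) × (Fin M → ℂ) → Form M m}
    (hσ : IsGermSection (U ×ˢ cube k) (fun p => graphPt J p.1 (φ p.2)) σ) :
    ContinuousOn (fun p : (Idx J → ℂ) × (Fin k → ℝ) => σ p (graphPt J p.1 (φ p.2)) (u p.2))
      (U ×ˢ cube k) :=
  (hσ.continuousOn_eval (continuousOn_graphPt_cube hφ _)).eval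
    (hu.comp continuous_snd).continuousOn

variable {φ : (Fin m → ℝ) → Fin M → ℂ} {U : Set (Idx J → ℂ)}
  {σ : (Idx J → ℂ) × (Fin m → ℝ) → (Fin n → ℂ) × (Fin M → ℂ) → Form M m}

theorem IsGermSection.coeffDeriv {k : ℕ} {φ : (Fin k → ℝ) → Fin M → ℂ}
    {σ : (Idx J → ℂ) × (Fin k → ℝ) → (Fin n → ℂ) × (Fin M → ℂ) → Form M m}
    (hσ : IsGermSection (U ×ˢ cube k) (fun p => graphPt J p.1 (φ p.2)) σ) (i : Idx J) :
    IsGermSection (U ×ˢ cube k) (fun p => graphPt J p.1 (φ p.2))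
      (fun p => AHyp.coeffDeriv i (σ p)) :=
  hσ.map _ (fun _ _ h => h.coeffDeriv i) (fun _ _ _ h => coeffDeriv_congr h)

theorem IsGermSection.foldr_coeffDeriv {k : ℕ} {φ : (Fin k → ℝ) → Fin M → ℂ}
    {σ : (Idx J → ℂ) × (Fin k → ℝ) → (Fin n → ℂ) × (Fin M → ℂ) → Form M m}
    (hσ : IsGermSection (U ×ˢ cube k) (fun p => graphPt J p.1 (φ p.2)) σ) (l : List (Idx J)) :
    IsGermSection (U ×ˢ cube k) (fun p => graphPt J p.1 (φ p.2))
      (fun p => l.foldr AHyp.coeffDeriv (σ p)) :=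
  hσ.map (fun s => l.foldr AHyp.coeffDeriv s) (fun _ _ h => h.foldr_coeffDeriv l)
    (fun _ _ _ h => foldr_coeffDeriv_congr h l)

theorem isCompact_cube (k : ℕ) : IsCompact (cube k) := isCompact_Icc

theorem continuous_tangent (hφ : ContDiff ℝ (⊤ : ℕ∞) φ) :
    Continuous fun t => fun q => fderiv ℝ φ t (Pi.single q 1) :=
  continuous_pi fun q => continuous_fderiv_single hφ q

theorem IsGermSection.integrableOn (hφ : ContDiff ℝ (⊤ : ℕ∞) φ)
    (hσ : IsGermSection (U ×ˢ cube m) (fun p => graphPt J p.1 (φ p.2)) σ) {a : Idx J → ℂ}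
    (ha : a ∈ U) : IntegrableOn (fun t => σ (a, t) (graphPt J a (φ t))
      fun q => fderiv ℝ φ t (Pi.single q 1)) (cube m) :=
  ((hσ.continuousOn_integrand hφ.continuous (continuous_tangent hφ)).comp
    (Continuous.prodMk_right a).continuousOn (fun _ ht => ⟨ha, ht⟩)).integrableOn_compact
    (isCompact_cube m)

/-- Differentiation of the integral of a section of germs with respect to the coefficients. -/
theorem IsGermSection.hasFDerivAt_germIntegral (hU : IsOpen U) (hφ : ContDiff ℝ (⊤ : ℕ∞) φ)
    (hσ : IsGermSection (U ×ˢ cube m) (fun p => graphPt J p.1 (φ p.2)) σ) {a : Idx J → ℂ}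
    (ha : a ∈ U) : HasFDerivAt (germIntegral φ σ)
      (∑ k : Idx J, (ContinuousLinearMap.proj k : (Idx J → ℂ) →L[ℂ] ℂ).smulRight
        (germIntegral φ (fun p => AHyp.coeffDeriv k (σ p)) a)) a := by
  have hcont := fun k => (hσ.coeffDeriv k).continuousOn_integrand hφ.continuous
    (continuous_tangent hφ)
  have h := hasFDerivAt_setIntegral_of_continuousOn (μ := volume) (𝕜 := ℂ) hU (isCompact_cube m)
    (h := fun a t => σ (a, t) (graphPt J a (φ t)) fun q => fderiv ℝ φ t (Pi.single q 1))
    (h' := fun a t => ∑ k : Idx J, (ContinuousLinearMap.proj k : (Idx J → ℂ) →L[ℂ] ℂ).smulRight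
      (AHyp.coeffDeriv k (σ (a, t)) (graphPt J a (φ t))
        fun q => fderiv ℝ φ t (Pi.single q 1)))
    (hσ.continuousOn_integrand hφ.continuous (continuous_tangent hφ)) ?_ ?_ ha
  · refine h.congr_fderiv ?_
    rw [integral_finsetSum]
    · refine Finset.sum_congr rfl fun k _ => ?_
      exact ((ContinuousLinearMap.smulRightL ℂ (Idx J → ℂ) ℂ
        (ContinuousLinearMap.proj k)).integral_comp_comm ((hσ.coeffDeriv k).integrableOn hφ ha))
    · intro k _
      exact (ContinuousLinearMap.smulRightL ℂ (Idx J → ℂ) ℂ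
        (ContinuousLinearMap.proj k)).integrable_comp ((hσ.coeffDeriv k).integrableOn hφ ha)
  · refine continuousOn_finsetSum _ fun k _ => ?_
    exact (ContinuousLinearMap.smulRightL ℂ (Idx J → ℂ) ℂ
        (ContinuousLinearMap.proj k)).continuous.comp_continuousOn (hcont k)
  · intro b hb t ht
    have h1 := ((hσ.holAt (b, t) ⟨hb, ht⟩).hasFDerivAt_comp_graphPt).continuousAlternatingMap_apply_const
      (fun q => fderiv ℝ φ t (Pi.single q 1))
    -- For `b'` near `b` the germ comes from the fixed function element `σ (b, t)`, so only the base
    -- point varies when differentiating.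
    have h2 : ∀ᶠ b' in 𝓝 b, σ (b', t) =ᶠ[𝓝 (graphPt J b' (φ t))] σ (b, t) := by
      have h3 : Tendsto (fun b' : Idx J → ℂ => (b', t)) (𝓝 b) (𝓝[U ×ˢ cube m] (b, t)) := by
        refine tendsto_nhdsWithin_iff.2 ⟨(Continuous.prodMk_left t).tendsto b, ?_⟩
        filter_upwards [hU.mem_nhds hb] with b' hb'
        exact ⟨hb', ht⟩
      exact h3.eventually (hσ.locallyConstant (b, t) ⟨hb, ht⟩)
    refine (h1.congr_of_eventuallyEq (h2.mono fun b' hb' => ?_)).congr_fderiv ?_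
    · show σ (b', t) _ _ = _
      rw [hb'.self_of_nhds]
    · ext v
      simp [ContinuousAlternatingMap.sum_apply]

end Integrals

/-! ### Derivatives of periods and the homogeneity equations for the rows `e_i` -/

section Periods

variable {M m n : ℕ} {J : Fin n → Finset (Fin M → ℕ)} {D : Set (Fin n → ℂ)}
  {E : Set (Fin M → ℂ)} {g : MultivaluedHol (F := ℂ) D} {η : MultivaluedHol (F := Form M m) E}
  {U : Set (Idx J → ℂ)}

theorem LoadedCube.isGermSection {k : ℕ} (c : LoadedCube J g η U k) :
    IsGermSection (U ×ˢ cube k) (fun p => graphPt J p.1 (c.map p.2))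
      (fun p => c.coeff p.1 p.2) where
  holAt p hp := (c.coeff_mem p.1 hp.1 p.2 hp.2).holAt (c.polyMap_mem p.1 hp.1 p.2 hp.2)
    (c.map_mem p.2 hp.2)
  locallyConstant p hp := c.coeff_locallyConstant p.1 hp.1 p.2 hp.2

/-- The integral over `C` of the forms obtained from those of `C` by the operators
`x^j ∂/∂z_i`, `(i, j) ∈ l`. -/
noncomputable def derivPeriod (C : PreChain J g η U m) (l : List (Idx J)) (a : Idx J → ℂ) : ℂ :=
  C.sum fun c r => r * germIntegral c.map (fun p => l.foldr coeffDeriv (c.coeff p.1 p.2)) a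

theorem hasFDerivAt_derivPeriod (hU : IsOpen U) (C : PreChain J g η U m) (l : List (Idx J))
    {a : Idx J → ℂ} (ha : a ∈ U) : HasFDerivAt (derivPeriod C l)
      (∑ k : Idx J, (ContinuousLinearMap.proj k : (Idx J → ℂ) →L[ℂ] ℂ).smulRight
        (derivPeriod C (k :: l) a)) a := by
  have h := HasFDerivAt.fun_sum (u := C.support) (fun c _ =>
    ((c.isGermSection.foldr_coeffDeriv l).hasFDerivAt_germIntegral hU c.smooth ha).const_mul (C c))
  refine HasFDerivAt.congr_fderiv h ?_
  ext v
  simp only [derivPeriod, Finsupp.sum, sum_apply, smul_apply,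
    ContinuousLinearMap.smulRight_apply, smul_eq_mul, Finset.mul_sum, List.foldr_cons]
  rw [Finset.sum_comm]
  refine Finset.sum_congr rfl fun k _ => Finset.sum_congr rfl fun c _ => ?_
  ring

theorem fderiv_derivPeriod_single (hU : IsOpen U) (C : PreChain J g η U m) (l : List (Idx J))
    {a : Idx J → ℂ} (ha : a ∈ U) (k : Idx J) :
    fderiv ℂ (derivPeriod C l) a (Pi.single k 1) = derivPeriod C (k :: l) a := by
  rw [(hasFDerivAt_derivPeriod hU C l ha).fderiv]
  simp only [sum_apply, ContinuousLinearMap.smulRight_apply, ContinuousLinearMap.proj_apply]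
  rw [Finset.sum_eq_single k]
  · simp
  · intro k' _ hk'
    simp [Pi.single_eq_of_ne hk']
  · simp

theorem differentiableOn_period (hU : IsOpen U) (C : PreChain J g η U m) :
    DifferentiableOn ℂ (period C) U := fun _ ha =>
  -- The period is by definition `derivPeriod C []`.
  (hasFDerivAt_derivPeriod hU C [] ha).differentiableAt.differentiableWithinAt

/-- Each further derivative in the direction `a_k` puts `k` at the head of the list, which matches
peeling off the first argument of `iteratedFDeriv`. Smoothness of the period is needed to move the
evaluation at fixed vectors inside the derivative. -/
theorem iteratedFDeriv_period (hU : IsOpen U) (C : PreChain J g η U m) (q : ℕ) (k : Fin q → Idx J)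
    {a : Idx J → ℂ} (ha : a ∈ U) :
    iteratedFDeriv ℂ q (period C) a (fun s => Pi.single (k s) 1) =
      derivPeriod C (List.ofFn k) a := by
  induction q generalizing a with
  | zero => simp [period, derivPeriod, germIntegral, LoadedCube.integral]
  | succ q ih =>
    have hc : ContDiffAt ℂ (q + 1 : ℕ) (period C) a :=
      (contDiffOn_of_differentiableOn hU (q + 1) (differentiableOn_period hU C)).contDiffAt
        (hU.mem_nhds ha)
    have hd : DifferentiableAt ℂ (iteratedFDeriv ℂ q (period C)) a :=
      hc.differentiableAt_iteratedFDeriv (by exact_mod_cast Nat.lt_succ_self q)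
    have h1 := hd.hasFDerivAt.continuousMultilinear_apply_const
      (fun s : Fin q => (Pi.single (k s.succ) 1 : Idx J → ℂ))
    have h2 : (fun b => iteratedFDeriv ℂ q (period C) b fun s => Pi.single (k s.succ) 1) =ᶠ[𝓝 a]
        derivPeriod C (List.ofFn fun s => k s.succ) := by
      filter_upwards [hU.mem_nhds ha] with b hb
      exact ih _ hb
    rw [iteratedFDeriv_succ_apply_left, List.ofFn_succ, ← fderiv_derivPeriod_single hU C _ ha,
      ← h2.fderiv_eq, h1.fderiv]
    rfl

theorem derivPeriod_congr (C : PreChain J g η U m) {l₁ l₂ : List (Idx J)}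
    (hl : (l₁.map (exponentVectors J)).sum = (l₂.map (exponentVectors J)).sum) {a : Idx J → ℂ}
    (ha : a ∈ U) : derivPeriod C l₁ a = derivPeriod C l₂ a := by
  unfold derivPeriod germIntegral
  refine Finsupp.sum_congr fun c _ => ?_
  congr 1
  refine setIntegral_congr_fun measurableSet_Icc fun t ht => ?_
  show _ = _
  simp only [(c.isGermSection.holAt (a, t) ⟨ha, ht⟩).foldr_coeffDeriv_eq_of_sum_eq hl]

theorem sum_mul_fderiv_period (hU : IsOpen U) (C : PreChain J g η U m) {a : Idx J → ℂ}
    (ha : a ∈ U) (w : Idx J → ℂ) : ∑ k, w k * fderiv ℂ (period C) a (Pi.single k 1) =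
      C.sum fun c r => r * ∫ t in cube m, ∑ k, w k *
        coeffDeriv k (c.coeff a t) (graphPt J a (c.map t))
          fun q => fderiv ℝ c.map t (Pi.single q 1) := by
  have h : ∀ k, fderiv ℂ (period C) a (Pi.single k 1) = derivPeriod C [k] a := fun k =>
    fderiv_derivPeriod_single hU C [] ha k
  simp only [h, derivPeriod, Finsupp.sum, Finset.mul_sum]
  rw [Finset.sum_comm]
  refine Finset.sum_congr rfl fun c _ => ?_
  rw [integral_finsetSum _ fun k _ =>
    ((c.isGermSection.coeffDeriv k).integrableOn c.smooth ha).const_mul (w k), Finset.mul_sum]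
  refine Finset.sum_congr rfl fun k _ => ?_
  rw [integral_const_mul]
  simp only [germIntegral, List.foldr_cons, List.foldr_nil]
  ring

/-- The homogeneity equations for the rows `e_i`. -/
theorem homogeneity_period_inl {α : Fin n → ℂ} (hg : QuasiHomogeneousFun g α) (hU : IsOpen U)
    (C : PreChain J g η U m) {a : Idx J → ℂ} (ha : a ∈ U) (i : Fin n) :
    ∑ k, (exponentVectors J k (Sum.inl i) : ℂ) * a k * fderiv ℂ (period C) a (Pi.single k 1) =
      α i * period C a := by
  rw [sum_mul_fderiv_period hU C ha, period, Finsupp.mul_sum]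
  refine Finsupp.sum_congr fun c _ => ?_
  rw [mul_left_comm (α i), LoadedCube.integral, ← integral_const_mul (α i)]
  refine congrArg (C c * ·) ?_
  refine setIntegral_congr_fun measurableSet_Icc fun t ht => ?_
  show _ = _
  -- The factor `z_i` of the Euler equation is `f_i(x) = ∑_j a_{ij} x^j` on the graph; only the
  -- block `i` of coefficients contributes.
  rw [← (c.coeff_mem a ha t ht).quasiHomogeneous_fst hg (c.polyMap_mem a ha t ht)
    (c.map_mem t ht) i, Fintype.sum_sigma, Finset.sum_eq_single i]
  · have : (graphPt J a (c.map t)).1 i = ∑ j : J i, a ⟨i, j⟩ * monomialAt j.1 (c.map t) := rfl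
    rw [this, Finset.sum_mul]
    refine Finset.sum_congr rfl fun j _ => ?_
    simp only [exponentVectors, Sum.elim_inl, Pi.single_eq_same, coeffDeriv, zDeriv,
      ContinuousAlternatingMap.smul_apply, smul_eq_mul, Int.cast_one, one_mul]
    simp only [graphPt]
    ring
  · intro i' _ hi'
    simp [exponentVectors, Pi.single_eq_of_ne hi'.symm]
  · simp

end Periods
end AHyp

namespace AHyp

open MeasureTheory

/-! ### Exterior derivatives and forms of top degree -/

section ClosedForms

variable {M m : ℕ}

theorem Form.map_cons_removeNth {k : ℕ} (f : Form M (k + 1)) (v : Fin M → ℂ)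
    (X : Fin (k + 1) → Fin M → ℂ) (q : Fin (k + 1)) :
    f (Matrix.vecCons v (q.removeNth X)) = (-1) ^ (q : ℕ) * f (Function.update X q v) := by
  have h := f.neg_one_pow_smul_map_insertNth q v (q.removeNth X)
  rw [← h, Fin.insertNth_removeNth, zsmul_eq_mul]
  simp

/-- The exterior derivative in terms of replacing one vector. -/
theorem alternatizeUncurryFin_cons (f : (Fin M → ℂ) →L[ℂ] Form M m) (v : Fin M → ℂ)
    (X : Fin m → Fin M → ℂ) :
    ContinuousAlternatingMap.alternatizeUncurryFin f (Matrix.vecCons v X) =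
      f v X - ∑ q, f (X q) (Function.update X q v) := by
  rw [ContinuousAlternatingMap.alternatizeUncurryFin_apply, Fin.sum_univ_succ, sub_eq_add_neg,
    ← Finset.sum_neg_distrib]
  congr 1
  · simp [Fin.removeNth_zero, Matrix.vecCons]
  · refine Finset.sum_congr rfl fun q _ => ?_
    obtain _ | k := m
    · exact q.elim0
    have hrem : q.succ.removeNth (Matrix.vecCons v X) = Matrix.vecCons v (q.removeNth X) := by
      funext r
      refine Fin.cases ?_ (fun r => ?_) r
      · simp [Fin.removeNth]
      · simp [Fin.removeNth]
    rw [hrem, Form.map_cons_removeNth, Matrix.cons_val_succ, Fin.val_succ, zsmul_eq_mul]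
    push_cast
    -- The sign `(-1)^(q+1)` of the exterior derivative and the sign `(-1)^q` of moving `v` to slot
    -- `q` combine to `-1`.
    rw [← mul_assoc, ← pow_add, Odd.neg_one_pow (⟨q, by ring⟩ : Odd ((q : ℕ) + 1 + q)), neg_one_mul]

theorem Form.eq_zero_of_lt (f : Form M m) (h : M < m) : f = 0 := by
  ext V
  refine f.toAlternatingMap.map_linearDependent V fun hV => ?_
  have := hV.fintype_card_le_finrank
  simp at this
  omega

/-- If `V` is a basis and `x = ∑ c_b V_b` with `c_r ≠ 0`, then replacing `V_r` by `x` multiplies the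
value of `f` by `c_r`, while the new value is zero by hypothesis. On dependent vectors `f` vanishes
anyway. -/
theorem Form.eq_zero_of_map_cons_eq_zero {k : ℕ} (f : Form (k + 1) (k + 1)) {x : Fin (k + 1) → ℂ}
    (hx : x ≠ 0) (h : ∀ X : Fin k → Fin (k + 1) → ℂ, f (Matrix.vecCons x X) = 0) : f = 0 := by
  ext V
  by_cases hV : LinearIndependent ℂ V
  · have hspan : x ∈ Submodule.span ℂ (Set.range V) := by
      rw [hV.span_eq_top_of_card_eq_finrank' (by simp)]
      trivial
    obtain ⟨c, hc⟩ := (Submodule.mem_span_range_iff_exists_fun ℂ).1 hspan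
    obtain ⟨r, hr⟩ : ∃ r, c r ≠ 0 := by
      by_contra! hcon
      exact hx (by rw [← hc]; simp [hcon])
    have h1 : f (Function.update V r x) = c r * f V := by
      rw [← hc]
      refine (f.toMultilinearMap.map_update_sum Finset.univ r _ V).trans ?_
      show ∑ b, f (Function.update V r (c b • V b)) = _
      rw [Finset.sum_eq_single r]
      · rw [f.map_update_smul, Function.update_eq_self, smul_eq_mul]
      · intro b _ hb
        rw [f.map_update_smul]
        refine (congrArg (c b • ·) (f.map_update_self V hb.symm)).trans (smul_zero _)
      · simp
    have h2 := f.map_cons_removeNth x V r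
    rw [h, h1] at h2
    simpa [hr] using h2.symm
  · exact f.toAlternatingMap.map_linearDependent V hV

end ClosedForms

/-! ### Lie derivatives on the graph, closedness and Cartan's formula -/

section LieDerivative

variable {M m n : ℕ} {J : Fin n → Finset (Fin M → ℕ)}

/-- Along the line `x + t x_p e_p` the monomial is `(1 + t)^(j_p) x^j`. Scaling the direction by
`x_p` avoids dividing by a coordinate that may be zero. -/
theorem fderiv_monomialAt_single (j : Fin M → ℕ) (x : Fin M → ℂ) (p : Fin M) :
    fderiv ℂ (monomialAt j) x (Pi.single p (x p)) = j p * monomialAt j x := by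
  have hl : HasDerivAt (fun t : ℂ => x + t • (Pi.single p (x p) : Fin M → ℂ)) (Pi.single p (x p))
      0 := by
    simpa using ((hasDerivAt_id (0 : ℂ)).smul_const (Pi.single p (x p) : Fin M → ℂ)).const_add x
  have hd : HasFDerivAt (monomialAt j) (fderiv ℂ (monomialAt j) x)
      (x + (0 : ℂ) • (Pi.single p (x p) : Fin M → ℂ)) := by
    simpa using (differentiable_monomialAt j x).hasFDerivAt
  have h1 := hd.comp_hasDerivAt 0 hl
  have h2 : (monomialAt j ∘ fun t : ℂ => x + t • (Pi.single p (x p) : Fin M → ℂ)) =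
      fun t => (1 + t) ^ j p * monomialAt j x := by
    funext t
    simp only [monomialAt, Function.comp]
    rw [← Finset.mul_prod_erase _ _ (Finset.mem_univ p),
      ← Finset.mul_prod_erase _ (fun p => x p ^ j p) (Finset.mem_univ p), ← mul_assoc]
    congr 1
    · simp only [Pi.add_apply, Pi.smul_apply, Pi.single_eq_same, smul_eq_mul]
      rw [← mul_pow]
      ring
    · refine Finset.prod_congr rfl fun r hr => ?_
      simp [Pi.single_eq_of_ne (Finset.ne_of_mem_erase hr)]
  rw [h2] at h1
  have h3 : HasDerivAt (fun t : ℂ => (1 + t) ^ j p * monomialAt j x)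
      (j p * monomialAt j x) 0 := by
    have := (((hasDerivAt_id (0 : ℂ)).const_add 1).pow (j p)).mul_const (monomialAt j x)
    simpa using this
  exact h1.unique h3

/-- The field `x_p ∂/∂x_p` lifts to the graph with `z`-component `∑ j_p a_{ij} x^j e_i`: this
produces the operator of row `p` of the hypergeometric system. -/
theorem fderiv_graphPt_single (a : Idx J → ℂ) (x : Fin M → ℂ) (p : Fin M) :
    fderiv ℂ (graphPt J a) x (Pi.single p (x p)) = (0, Pi.single p (x p)) +
      ∑ k : Idx J, ((k.2.1 p : ℂ) * a k * monomialAt k.2.1 x) •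
        ((Pi.single k.1 1 : Fin n → ℂ), (0 : Fin M → ℂ)) := by
  have h : graphPt J a = fun x => (∑ k : Idx J, monomialAt k.2.1 x •
      (a k • ((Pi.single k.1 1 : Fin n → ℂ), (0 : Fin M → ℂ)))) + (0, x) := by
    funext x
    rw [graphPt, polyMap_eq_sum]
    refine Prod.ext ?_ ?_
    · simp [Prod.fst_sum, smul_smul, mul_comm]
    · simp [Prod.snd_sum]
  have hd : HasFDerivAt (graphPt J a) ((∑ k : Idx J, (fderiv ℂ (monomialAt k.2.1) x).smulRight
      (a k • ((Pi.single k.1 1 : Fin n → ℂ), (0 : Fin M → ℂ)))) +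
        ContinuousLinearMap.inr ℂ (Fin n → ℂ) (Fin M → ℂ)) x := by
    rw [h]
    refine HasFDerivAt.add (HasFDerivAt.fun_sum fun k _ => ?_)
      (ContinuousLinearMap.inr ℂ (Fin n → ℂ) (Fin M → ℂ)).hasFDerivAt
    exact (differentiable_monomialAt k.2.1 x).hasFDerivAt.smul_const _
  rw [hd.fderiv, add_comm ((0 : Fin n → ℂ), (Pi.single p (x p) : Fin M → ℂ))]
  simp only [add_apply, sum_apply, ContinuousLinearMap.smulRight_apply, fderiv_monomialAt_single,
    ContinuousLinearMap.inr_apply, smul_smul]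
  congr 1
  refine Finset.sum_congr rfl fun k _ => ?_
  congr 1
  ring

variable {D : Set (Fin n → ℂ)} {E : Set (Fin M → ℂ)} {g : MultivaluedHol (F := ℂ) D}
  {η : MultivaluedHol (F := Form M m) E} {a : Idx J → ℂ} {x : Fin M → ℂ}
  {s : (Fin n → ℂ) × (Fin M → ℂ) → Form M m} {α : Fin n → ℂ} {β : Fin M → ℂ}

theorem HolAt.hasFDerivAt_restrict_graph (hs : HolAt s (graphPt J a x)) :
    HasFDerivAt (fun x => s (graphPt J a x))
      ((fderiv ℂ s (graphPt J a x)).comp (fderiv ℂ (graphPt J a) x)) x :=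
  hs.differentiableAt.hasFDerivAt.comp x (differentiable_graphPt a x).hasFDerivAt

/-- The Lie derivative along `x_p ∂/∂x_p` of the restriction to the graph of `f_a` of a section of
the local system. -/
theorem InLocalSystem.lieDeriv_restrict_graph (hη : QuasiHomogeneousForm η β)
    (h : InLocalSystem g η (graphPt J a x) s) (h1 : polyMap J a x ∈ D) (h2 : x ∈ E) (p : Fin M)
    (X : Fin m → Fin M → ℂ) :
    lieDeriv p (fun x => s (graphPt J a x)) x X =
      ∑ k : Idx J, (k.2.1 p : ℂ) * a k * coeffDeriv k s (graphPt J a x) X +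
        β p * s (graphPt J a x) X := by
  have hs : HolAt s (graphPt J a x) := h.holAt h1 h2
  rw [lieDeriv, hs.hasFDerivAt_restrict_graph.fderiv, ContinuousLinearMap.comp_apply,
    fderiv_graphPt_single, ← h.quasiHomogeneous_snd hη h1 h2 p X]
  simp only [map_add, map_sum, ContinuousLinearMap.map_smul, ContinuousAlternatingMap.add_apply,
    ContinuousAlternatingMap.sum_apply, ContinuousAlternatingMap.smul_apply, smul_eq_mul,
    coeffDeriv, zDeriv]
  have : (graphPt J a x).2 = x := rfl
  simp only [this]
  rw [add_comm (fderiv ℂ s _ _ _), add_assoc]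
  congr 1
  refine Finset.sum_congr rfl fun k _ => ?_
  ring

theorem sum_single_self (x : Fin M → ℂ) : ∑ p, (Pi.single p (x p) : Fin M → ℂ) = x := by
  ext r; simp

theorem sum_update_single_self (f : Form M m) (X : Fin m → Fin M → ℂ) :
    ∑ p, ∑ q, f (Function.update X q (Pi.single p (X q p))) = m * f X := by
  rw [Finset.sum_comm]
  have h : ∀ q, ∑ p, f (Function.update X q (Pi.single p (X q p))) = f X := by
    intro q
    refine (f.toMultilinearMap.map_update_sum Finset.univ q _ X).symm.trans ?_
    rw [sum_single_self, Function.update_eq_self]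
    rfl
  simp [h]

/-- In the projective case the form `g(f(x)) η` is invariant under the Euler field. -/
theorem InLocalSystem.sum_lieDeriv_restrict_graph {d : Fin n → ℕ}
    (hg : QuasiHomogeneousFun g α) (hη : QuasiHomogeneousForm η β)
    (hX : DescendsToProjective J d η α β)
    (h : InLocalSystem g η (graphPt J a x) s) (h1 : polyMap J a x ∈ D) (h2 : x ∈ E)
    (X : Fin m → Fin M → ℂ) :
    ∑ p, lieDeriv p (fun x => s (graphPt J a x)) x X = 0 := by
  have hi : ∀ i, (d i : ℂ) * (α i * s (graphPt J a x) X) =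
      ∑ j : J i, ∑ p, (j.1 p : ℂ) * a ⟨i, j⟩ * coeffDeriv ⟨i, j⟩ s (graphPt J a x) X := by
    intro i
    rw [← h.quasiHomogeneous_fst hg h1 h2 i X]
    have : (graphPt J a x).1 i = ∑ j : J i, a ⟨i, j⟩ * monomialAt j.1 x := rfl
    rw [this, Finset.sum_mul, Finset.mul_sum]
    refine Finset.sum_congr rfl fun j _ => ?_
    simp only [coeffDeriv, zDeriv, ContinuousAlternatingMap.smul_apply, smul_eq_mul, graphPt]
    rw [← hX.homogeneous i j.1 j.2, ← Finset.sum_mul, ← Finset.sum_mul]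
    push_cast
    ring
  have hsum : ∑ p, ∑ k : Idx J, (k.2.1 p : ℂ) * a k * coeffDeriv k s (graphPt J a x) X =
      ∑ i, (d i : ℂ) * (α i * s (graphPt J a x) X) := by
    simp only [hi]
    rw [Finset.sum_comm, Fintype.sum_sigma]
  -- The total factor is `∑ d_i α_i + ∑ β_p`, which is zero by the degree condition.
  simp only [h.lieDeriv_restrict_graph hη h1 h2, Finset.sum_add_distrib, hsum, ← mul_assoc,
    ← Finset.sum_mul, ← add_mul, hX.degree, zero_mul]

/-- The form vanishes whenever one slot is the base point, and this persists for base points near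
`x`. Differentiating that identity in the direction `X q` gives one term from the form and one from
the slot `q`, which sum to zero. -/
theorem InLocalSystem.map_update_restrict_graph {d : Fin n → ℕ}
    (hX : DescendsToProjective J d η α β)
    (h : InLocalSystem g η (graphPt J a x) s) (h1 : polyMap J a x ∈ D) (h2 : x ∈ E)
    (X : Fin m → Fin M → ℂ) (q : Fin m) :
    fderiv ℂ (fun x => s (graphPt J a x)) x (X q) (Function.update X q x) =
      - s (graphPt J a x) X := by
  have hs : HolAt s (graphPt J a x) := h.holAt h1 h2
  have hθ := hs.hasFDerivAt_restrict_graph.differentiableAt.hasFDerivAt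
  have hd := hθ.continuousAlternatingMap_apply (g := fun i x' => Function.update X q x' i)
    (g' := fun i => if i = q then ContinuousLinearMap.id ℂ _ else 0) (fun i => by
      by_cases hi : i = q
      · subst hi
        simp only [Function.update_self, if_true]
        exact hasFDerivAt_id x
      · simp only [Function.update_of_ne hi, if_neg hi]
        exact hasFDerivAt_const (X i) x)
  have hz : (fun x' => s (graphPt J a x') fun i => Function.update X q x' i) =ᶠ[𝓝 x] fun _ => 0 := by
    have hev := (differentiable_graphPt a).continuous.continuousAt.eventually
      ((h.eventually h1 h2).and (continuousAt_snd.eventually (η.isOpen.mem_nhds h2)))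
    filter_upwards [hev] with x' hx'
    exact hx'.1.map_eq_zero_of_eq_snd hX hx'.2 _ q (by simp [graphPt])
  have h0 := congrArg (· (X q)) (hd.unique ((hasFDerivAt_const (0 : ℂ) x).congr_of_eventuallyEq hz))
  simp only [add_apply, sum_apply, ContinuousLinearMap.comp_apply] at h0
  rw [Finset.sum_eq_single q (fun i _ hi => by simp [hi]) (by simp)] at h0
  simp at h0
  exact eq_neg_of_add_eq_zero_left h0

/-- The restriction of a section of the local system to the graph of `f_a` is a closed form. -/
theorem InLocalSystem.closed_restrict_graph {X : Ambient} {d : Fin n → ℕ}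
    (hM : M = X.coords m) (hg : QuasiHomogeneousFun g α) (hη : QuasiHomogeneousForm η β)
    (hX : X = .projective → DescendsToProjective J d η α β)
    (h : InLocalSystem g η (graphPt J a x) s) (h1 : polyMap J a x ∈ D) (h2 : x ∈ E) :
    ContinuousAlternatingMap.alternatizeUncurryFin
      (fderiv ℂ (fun x => s (graphPt J a x)) x) = 0 := by
  cases X with
  | affine => exact Form.eq_zero_of_lt _ (by rw [hM]; exact Nat.lt_succ_self m)
  | projective =>
    have hM' : M = m + 1 := hM
    subst hM'
    have hX := hX rfl
    have hx : x ≠ 0 := fun hx => hX.zero_notMem (hx ▸ h2)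
    -- By top degree it is enough to contract with `x`. The contraction of the exterior derivative
    -- with the Euler field is the Lie derivative along it, because the form itself is killed by
    -- that field; and this Lie derivative is zero.
    refine Form.eq_zero_of_map_cons_eq_zero _ hx fun X => ?_
    rw [alternatizeUncurryFin_cons]
    simp only [h.map_update_restrict_graph hX h1 h2]
    have hsum := h.sum_lieDeriv_restrict_graph hg hη hX h1 h2 X
    simp only [lieDeriv, Finset.sum_add_distrib, sum_update_single_self] at hsum
    rw [← ContinuousAlternatingMap.sum_apply, ← map_sum, sum_single_self] at hsum
    rw [← hsum]
    simp

/-- Cartan's formula for the closed form `s (f_a(x), x)`. -/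
theorem InLocalSystem.lieDeriv_eq_sum {X : Ambient} {d : Fin n → ℕ}
    (hM : M = X.coords m) (hg : QuasiHomogeneousFun g α) (hη : QuasiHomogeneousForm η β)
    (hX : X = .projective → DescendsToProjective J d η α β)
    (h : InLocalSystem g η (graphPt J a x) s) (h1 : polyMap J a x ∈ D) (h2 : x ∈ E) (p : Fin M)
    (V : Fin m → Fin M → ℂ) :
    lieDeriv p (fun x => s (graphPt J a x)) x V =
      ∑ q, (fderiv ℂ (fun x => s (graphPt J a x)) x (V q)
        (Function.update V q (Pi.single p (x p))) +
          s (graphPt J a x) (Function.update V q (Pi.single p (V q p)))) := by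
  have hc := alternatizeUncurryFin_cons (fderiv ℂ (fun x => s (graphPt J a x)) x)
    (Pi.single p (x p)) V
  rw [h.closed_restrict_graph hM hg hη hX h1 h2] at hc
  rw [lieDeriv, Finset.sum_add_distrib, sub_eq_zero.1 hc.symm]

end LieDerivative
end AHyp

namespace AHyp

open MeasureTheory

/-! ### Derivatives of maps on the cube, its boundary included -/

section Cubes

theorem uniqueDiffOn_cube (k : ℕ) : UniqueDiffOn ℝ (cube k) := by
  rw [cube, ← Set.pi_univ_Icc]
  exact UniqueDiffOn.univ_pi fun i => uniqueDiffOn_Icc (by simp)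

/-- Maps of cubes are defined on all of `ℝ^k`, but only their values on the cube matter; since the
cube is a set of unique differentiability, so do the derivatives there, even at boundary points. -/
theorem fderiv_eq_of_eqOn_cube {k : ℕ} {F : Type*} [NormedAddCommGroup F] [NormedSpace ℝ F]
    {φ ψ : (Fin k → ℝ) → F} (hφ : Differentiable ℝ φ) (hψ : Differentiable ℝ ψ)
    (h : Set.EqOn φ ψ (cube k)) {t : Fin k → ℝ} (ht : t ∈ cube k) :
    fderiv ℝ φ t = fderiv ℝ ψ t :=
  (uniqueDiffOn_cube k).eq ht (hφ t).hasFDerivAt.hasFDerivWithinAt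
    ((hψ t).hasFDerivAt.hasFDerivWithinAt.congr h (h ht))

theorem fderiv_comp_insertNth {k : ℕ} {F : Type*} [NormedAddCommGroup F] [NormedSpace ℝ F]
    {φ : (Fin (k + 1) → ℝ) → F} (hφ : Differentiable ℝ φ) (q : Fin (k + 1)) (e : ℝ)
    (t : Fin k → ℝ) (r : Fin k) :
    fderiv ℝ (fun t => φ (q.insertNth e t : Fin (k + 1) → ℝ)) t (Pi.single r 1) =
      fderiv ℝ φ (q.insertNth e t : Fin (k + 1) → ℝ) (Pi.single (q.succAbove r) 1) := by
  have hl : HasDerivAt (fun s : ℝ => t + s • (Pi.single r 1 : Fin k → ℝ)) (Pi.single r 1) 0 := by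
    simpa using ((hasDerivAt_id (0 : ℝ)).smul_const (Pi.single r 1 : Fin k → ℝ)).const_add t
  have hl' : HasDerivAt (fun s : ℝ => (q.insertNth e t : Fin (k + 1) → ℝ) +
      s • (Pi.single (q.succAbove r) 1 : Fin (k + 1) → ℝ)) (Pi.single (q.succAbove r) 1) 0 := by
    simpa using ((hasDerivAt_id (0 : ℝ)).smul_const
      (Pi.single (q.succAbove r) 1 : Fin (k + 1) → ℝ)).const_add
        (q.insertNth e t : Fin (k + 1) → ℝ)
  have heq : (fun s : ℝ => φ (q.insertNth e (t + s • (Pi.single r 1 : Fin k → ℝ)) :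
      Fin (k + 1) → ℝ)) = fun s => φ ((q.insertNth e t : Fin (k + 1) → ℝ) +
      s • (Pi.single (q.succAbove r) 1 : Fin (k + 1) → ℝ)) := by
    funext s
    congr 1
    funext i
    refine Fin.succAboveCases q ?_ (fun i => ?_) i
    · simp
    · by_cases hi : i = r
      · subst hi; simp
      · simp [Pi.single_eq_of_ne hi, Pi.single_eq_of_ne (fun h => hi (Fin.succAbove_right_injective h))]
  have hdiff : DifferentiableAt ℝ (fun t => φ (q.insertNth e t : Fin (k + 1) → ℝ)) t :=
    (hφ _).comp t ((contDiff_insertNth q e).differentiable (by simp) t)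
  have h1 : HasDerivAt (fun s : ℝ => φ (q.insertNth e (t + s • (Pi.single r 1 : Fin k → ℝ)) :
      Fin (k + 1) → ℝ)) _ 0 :=
    HasFDerivAt.comp_hasDerivAt (l := fun t => φ (q.insertNth e t : Fin (k + 1) → ℝ)) 0
      (by simpa using hdiff.hasFDerivAt) hl
  have h2 : HasDerivAt (fun s : ℝ => φ ((q.insertNth e t : Fin (k + 1) → ℝ) +
      s • (Pi.single (q.succAbove r) 1 : Fin (k + 1) → ℝ))) _ 0 :=
    HasFDerivAt.comp_hasDerivAt (l := φ) 0
      (by simpa using (hφ (q.insertNth e t : Fin (k + 1) → ℝ)).hasFDerivAt) hl'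
  rw [heq] at h1
  exact h1.unique h2

/-- On the cube `φ` coincides with `t ↦ φ (t with t_q = 0)`, which is constant in the direction `q`
on the whole space, and the two have equal derivatives on the cube. -/
theorem fderiv_single_eq_zero_of_const {k : ℕ} {F : Type*} [NormedAddCommGroup F]
    [NormedSpace ℝ F] {φ : (Fin k → ℝ) → F} (hφ : Differentiable ℝ φ) {q : Fin k}
    (h : ∀ t ∈ cube k, ∀ e ∈ Set.Icc (0 : ℝ) 1, φ (Function.update t q e) = φ t)
    {t : Fin k → ℝ} (ht : t ∈ cube k) : fderiv ℝ φ t (Pi.single q 1) = 0 := by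
  have hu : Differentiable ℝ fun t : Fin k → ℝ => Function.update t q 0 := by
    rw [differentiable_pi]
    intro i
    by_cases hi : i = q
    · subst hi; simp
    · simp only [Function.update_of_ne hi]; fun_prop
  have hψ : Differentiable ℝ fun t => φ (Function.update t q 0) := hφ.comp hu
  rw [fderiv_eq_of_eqOn_cube hφ hψ (fun t ht => (h t ht 0 (by simp)).symm) ht]
  have hl : HasDerivAt (fun s : ℝ => t + s • (Pi.single q 1 : Fin k → ℝ)) (Pi.single q 1) 0 := by
    simpa using ((hasDerivAt_id (0 : ℝ)).smul_const (Pi.single q 1 : Fin k → ℝ)).const_add t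
  have h1 : HasDerivAt (fun s : ℝ => φ (Function.update (t + s • (Pi.single q 1 : Fin k → ℝ)) q 0))
      _ 0 :=
    HasFDerivAt.comp_hasDerivAt (l := fun t => φ (Function.update t q 0)) 0
      (by simpa using (hψ t).hasFDerivAt) hl
  have heq : (fun s : ℝ => φ (Function.update (t + s • (Pi.single q 1 : Fin k → ℝ)) q 0)) =
      fun _ => φ (Function.update t q 0) := by
    funext s
    congr 1
    funext i
    by_cases hi : i = q
    · subst hi; simp
    · simp [hi]
  rw [heq] at h1
  exact h1.unique (hasDerivAt_const 0 _)

end Cubes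

/-! ### Identities for alternating forms -/

section AlternatingIdentities

variable {M m : ℕ}

/-- The terms with second derivatives in the divergence of a contracted form cancel. -/
theorem Form.sum_update_update_eq_zero (f : Form M m) (X : Fin m → Fin M → ℂ) (v : Fin M → ℂ)
    (W : Fin m → Fin m → Fin M → ℂ) (hW : ∀ i j, W i j = W j i) :
    ∑ q, ∑ i ∈ Finset.univ.erase q, f (Function.update (Function.update X q v) i (W q i)) = 0 := by
  have hanti : ∀ q i, q ≠ i → f (Function.update (Function.update X q v) i (W q i)) =
      - f (Function.update (Function.update X i v) q (W i q)) := by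
    intro q i hqi
    have h := f.toAlternatingMap.map_swap (Function.update (Function.update X i v) q (W i q)) hqi
    have hv : (Function.update (Function.update X i v) q (W i q)) ∘ Equiv.swap q i =
        Function.update (Function.update X q v) i (W q i) := by
      funext r
      by_cases hr : r = i
      · subst hr; simp [hW]
      · by_cases hr' : r = q
        · subst hr'; simp [hqi, hqi.symm]
        · simp [Equiv.swap_apply_of_ne_of_ne hr' hr, hr, hr']
    rw [hv] at h
    exact h
  have h1 : ∑ q, ∑ i ∈ Finset.univ.erase q,
      f (Function.update (Function.update X q v) i (W q i)) =
      - ∑ q, ∑ i ∈ Finset.univ.erase q,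
        f (Function.update (Function.update X q v) i (W q i)) := by
    conv_lhs => rw [Finset.sum_comm' (t' := Finset.univ) (s' := fun i => Finset.univ.erase i)
      (fun q i => by simp [ne_comm])]
    rw [← Finset.sum_neg_distrib]
    refine Finset.sum_congr rfl fun q _ => ?_
    rw [← Finset.sum_neg_distrib]
    exact Finset.sum_congr rfl fun i hi => hanti _ _ (Finset.ne_of_mem_erase hi)
  -- Exchanging `q` and `i` changes the sign of every term, so the sum equals its own negative.
  linear_combination h1 / 2

/-- In the multilinear expansion every term but one has a multiple of `x` in some slot. This absorbs
the term `dl · φ` in the tangent vectors of a rescaled cube `l φ`. -/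
theorem Form.map_add_smul_of_forall_eq_zero (f : Form M m) {x : Fin M → ℂ}
    (hf : ∀ (u : Fin m → Fin M → ℂ) (q : Fin m), u q = x → f u = 0) (w : Fin m → Fin M → ℂ)
    (c : Fin m → ℂ) : f (fun i => w i + c i • x) = f w := by
  have hker : ∀ (u : Fin m → Fin M → ℂ) (q : Fin m) (b : ℂ), u q = b • x → f u = 0 := by
    intro u q b hu
    have : u = Function.update u q (b • x) := by rw [← hu, Function.update_eq_self]
    rw [this, f.map_update_smul, hf _ q (by simp)]
    simp
  have h := f.toMultilinearMap.map_add_univ w (fun i => c i • x)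
  refine h.trans ?_
  rw [Finset.sum_eq_single Finset.univ]
  · simp
  · intro s _ hs
    obtain ⟨q, hq⟩ : ∃ q, q ∉ s := by
      by_contra! hcon
      exact hs (Finset.eq_univ_iff_forall.2 hcon)
    exact hker _ q (c q) (by simp [hq])
  · simp

end AlternatingIdentities

/-! ### Compatibility of the graph with rescaling -/

section Homogeneous

variable {M n : ℕ} {J : Fin n → Finset (Fin M → ℕ)} {d : Fin n → ℕ}

theorem graphPt_smul (hJ : ∀ i, ∀ j ∈ J i, ∑ p, j p = d i) (a : Idx J → ℂ) (x : Fin M → ℂ)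
    (l : ℂ) : graphPt J a (l • x) = (fun i => l ^ d i * (graphPt J a x).1 i, l • x) := by
  refine Prod.ext (funext fun i => ?_) rfl
  simp only [graphPt, polyMap, Finset.mul_sum]
  refine Finset.sum_congr rfl fun j _ => ?_
  rw [← hJ i j.1 j.2, ← Finset.prod_pow_eq_pow_sum]
  simp only [Pi.smul_apply, smul_eq_mul, mul_pow, Finset.prod_mul_distrib]
  ring

end Homogeneous
-- Stokes' formula for the contracted form on a cube
section Stokes

variable {M n k : ℕ} {J : Fin n → Finset (Fin M → ℕ)} {D : Set (Fin n → ℂ)}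
  {E : Set (Fin M → ℂ)} {g : MultivaluedHol (F := ℂ) D}
  {η : MultivaluedHol (F := Form M (k + 1)) E} {U : Set (Idx J → ℂ)} {X : Ambient}
  {d : Fin n → ℕ} {α : Fin n → ℂ} {β : Fin M → ℂ}

/-- The vectors `∂_q φ`, that at position `q` being replaced by `x_p ∂/∂x_p`. -/
noncomputable def contractedTangent (φ : (Fin (k + 1) → ℝ) → Fin M → ℂ) (p : Fin M)
    (q : Fin (k + 1)) (t : Fin (k + 1) → ℝ) : Fin (k + 1) → Fin M → ℂ :=
  Function.update (fun i => fderiv ℝ φ t (Pi.single i 1)) q (Pi.single p (φ t p))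

theorem continuous_contractedTangent {φ : (Fin (k + 1) → ℝ) → Fin M → ℂ}
    (hφ : ContDiff ℝ (⊤ : ℕ∞) φ) (p : Fin M) (q : Fin (k + 1)) :
    Continuous (contractedTangent φ p q) := by
  refine (continuous_tangent hφ).update q ?_
  exact (continuous_single p).comp ((continuous_apply p).comp hφ.continuous)

/-- The divergence of the contracted form, for a holomorphic form `θ`. -/
theorem sum_fderiv_contractedTangent {φ : (Fin (k + 1) → ℝ) → Fin M → ℂ}
    (hφ : ContDiff ℝ (⊤ : ℕ∞) φ) {t : Fin (k + 1) → ℝ} {θ : (Fin M → ℂ) → Form M (k + 1)}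
    (hθ : DifferentiableAt ℂ θ (φ t)) (p : Fin M) :
    (∀ q, DifferentiableAt ℝ (fun t => θ (φ t) (contractedTangent φ p q t)) t) ∧
    ∑ q, fderiv ℝ (fun t => θ (φ t) (contractedTangent φ p q t)) t (Pi.single q 1) =
      ∑ q, (fderiv ℂ θ (φ t) (fderiv ℝ φ t (Pi.single q 1)) (contractedTangent φ p q t) +
        θ (φ t) (Function.update (fun i => fderiv ℝ φ t (Pi.single i 1)) q
          (Pi.single p (fderiv ℝ φ t (Pi.single q 1) p)))) := by
  have hφd : HasFDerivAt φ (fderiv ℝ φ t) t := (hφ.differentiable (by simp) t).hasFDerivAt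
  have hφ2 : ContDiffAt ℝ 2 φ t := hφ.contDiffAt.of_le
    (WithTop.coe_le_coe.2 (le_top : (2 : ℕ∞) ≤ ⊤))
  have hdd : DifferentiableAt ℝ (fderiv ℝ φ) t :=
    (hφ2.fderiv_right (m := 1) (by norm_num)).differentiableAt (by norm_num)
  have hsymm : IsSymmSndFDerivAt ℝ φ t := hφ2.isSymmSndFDerivAt (by simp)
  -- The cube has real parameters, so the complex form is regarded as a real one before
  -- differentiating along `φ`.
  let L : Form M (k + 1) →L[ℝ] ((Fin M → ℂ) [⋀^Fin (k + 1)]→L[ℝ] ℂ) :=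
    ContinuousAlternatingMap.restrictScalarsCLM ℝ
  have hω : HasFDerivAt (fun t => L (θ (φ t)))
      (L.comp (((fderiv ℂ θ (φ t)).restrictScalars ℝ).comp (fderiv ℝ φ t))) t :=
    L.hasFDerivAt.comp t ((hθ.hasFDerivAt.restrictScalars ℝ).comp t hφd)
  let v' : (Fin (k + 1) → ℝ) →L[ℝ] (Fin M → ℂ) :=
    (ContinuousLinearMap.single ℝ (fun _ : Fin M => ℂ) p).comp
      ((ContinuousLinearMap.proj p).comp (fderiv ℝ φ t))
  let W : Fin (k + 1) → (Fin (k + 1) → ℝ) →L[ℝ] (Fin M → ℂ) := fun i =>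
    (fderiv ℝ (fderiv ℝ φ) t).flip (Pi.single i 1)
  have hvec : ∀ q i, HasFDerivAt (fun t => contractedTangent φ p q t i)
      (if i = q then v' else W i) t := by
    intro q i
    by_cases hi : i = q
    · subst hi
      simp only [contractedTangent, Function.update_self, if_true]
      exact (ContinuousLinearMap.single ℝ (fun _ : Fin M => ℂ) p).hasFDerivAt.comp t
        ((ContinuousLinearMap.proj (R := ℝ) (φ := fun _ : Fin M => ℂ) p).hasFDerivAt.comp t hφd)
    · simp only [contractedTangent, Function.update_of_ne hi, if_neg hi]
      exact (hdd.hasFDerivAt.clm_apply (hasFDerivAt_const (Pi.single i 1) t)).congr_fderiv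
        (by ext; simp [W])
  have hF : ∀ q, HasFDerivAt (fun t => θ (φ t) (contractedTangent φ p q t)) _ t := fun q =>
    hω.continuousAlternatingMap_apply (hvec q)
  refine ⟨fun q => (hF q).differentiableAt, ?_⟩
  have hval : ∀ q, fderiv ℝ (fun t => θ (φ t) (contractedTangent φ p q t)) t (Pi.single q 1) =
      (fderiv ℂ θ (φ t) (fderiv ℝ φ t (Pi.single q 1)) (contractedTangent φ p q t) +
        θ (φ t) (Function.update (fun i => fderiv ℝ φ t (Pi.single i 1)) q
          (Pi.single p (fderiv ℝ φ t (Pi.single q 1) p)))) +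
      ∑ i ∈ Finset.univ.erase q, θ (φ t) (Function.update (Function.update
        (fun i => fderiv ℝ φ t (Pi.single i 1)) q (Pi.single p (φ t p))) i
          (fderiv ℝ (fderiv ℝ φ) t (Pi.single q 1) (Pi.single i 1))) := by
    intro q
    rw [(hF q).fderiv]
    simp only [add_apply, sum_apply, ContinuousLinearMap.comp_apply]
    rw [← Finset.add_sum_erase _ _ (Finset.mem_univ q), ← add_assoc]
    refine congrArg₂ (· + ·) (congrArg₂ (· + ·) rfl ?_) (Finset.sum_congr rfl fun i hi => ?_)
    · rw [if_pos rfl]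
      show θ (φ t) (Function.update (contractedTangent φ p q t) q _) = _
      rw [contractedTangent, Function.update_idem]
      rfl
    · rw [if_neg (Finset.ne_of_mem_erase hi)]
      rfl
  simp only [hval]
  -- Mixed second derivatives of `φ` are symmetric, so the terms containing them cancel in pairs.
  rw [Finset.sum_add_distrib, Form.sum_update_update_eq_zero (θ (φ t)) _ _
    (fun q i => fderiv ℝ (fderiv ℝ φ) t (Pi.single q 1) (Pi.single i 1))
    (fun i j => hsymm.eq _ _), add_zero]

/-- The integral over a loaded cube of its form contracted with `x_p ∂/∂x_p`. -/
noncomputable def LoadedCube.contractedIntegral (p : Fin M) (a : Idx J → ℂ)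
    (c : LoadedCube J g η U k) : ℂ :=
  ∫ t in cube k, c.coeff a t (graphPt J a (c.map t))
    (Matrix.vecCons (Pi.single p (c.map t p)) fun q => fderiv ℝ c.map t (Pi.single q 1))

theorem LoadedCube.integrableOn_lieDeriv (hη : QuasiHomogeneousForm η β)
    (c : LoadedCube J g η U (k + 1)) {a : Idx J → ℂ} (ha : a ∈ U) (p : Fin M) :
    IntegrableOn (fun t => lieDeriv p (fun x => c.coeff a t (graphPt J a x)) (c.map t)
      fun q => fderiv ℝ c.map t (Pi.single q 1)) (cube (k + 1)) := by
  have h : IntegrableOn (fun t => ∑ i : Idx J, (i.2.1 p : ℂ) * a i *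
      coeffDeriv i (c.coeff a t) (graphPt J a (c.map t))
        (fun q => fderiv ℝ c.map t (Pi.single q 1)) +
      β p * c.coeff a t (graphPt J a (c.map t)) (fun q => fderiv ℝ c.map t (Pi.single q 1)))
      (cube (k + 1)) := by
    refine Integrable.add (integrable_finsetSum _ fun i _ => ?_) ?_
    · exact ((c.isGermSection.coeffDeriv i).integrableOn c.smooth ha).const_mul _
    · exact (c.isGermSection.integrableOn c.smooth ha).const_mul _
  refine h.congr_fun (fun t ht => ?_) measurableSet_Icc
  exact ((c.coeff_mem a ha t ht).lieDeriv_restrict_graph hη (c.polyMap_mem a ha t ht)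
    (c.map_mem t ht) p _).symm

theorem LoadedCube.coeff_eventuallyEq_of_mem_interior (c : LoadedCube J g η U (k + 1))
    {a : Idx J → ℂ} (ha : a ∈ U) {t₀ : Fin (k + 1) → ℝ} (ht₀ : cube (k + 1) ∈ 𝓝 t₀) :
    ∀ᶠ t in 𝓝 t₀, c.coeff a t (graphPt J a (c.map t)) = c.coeff a t₀ (graphPt J a (c.map t)) := by
  have h : Tendsto (fun t : Fin (k + 1) → ℝ => (a, t)) (𝓝 t₀)
      (𝓝[U ×ˢ cube (k + 1)] (a, t₀)) := by
    refine tendsto_nhdsWithin_iff.2 ⟨(Continuous.prodMk_right a).tendsto t₀, ?_⟩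
    filter_upwards [ht₀] with t ht
    exact ⟨ha, ht⟩
  filter_upwards [h.eventually (c.coeff_locallyConstant a ha t₀ (mem_of_mem_nhds ht₀))] with t ht
  exact ht.self_of_nhds

/-- On the face, `x_p ∂/∂x_p` occupies slot `q` among the tangent vectors of the cube; moving it to
the front costs the sign `(-1)^q`, which is that of the cubical boundary. -/
theorem LoadedCube.face_contractedIntegral (c : LoadedCube J g η U (k + 1)) (a : Idx J → ℂ)
    (p : Fin M) (q : Fin (k + 1)) {e : ℝ} (he : e ∈ Set.Icc (0 : ℝ) 1) :
    ∫ t in cube k, c.coeff a (q.insertNth e t)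
      (graphPt J a (c.map (q.insertNth e t)))
        (contractedTangent c.map p q (q.insertNth e t)) =
      (-1) ^ (q : ℕ) * (c.face q e he).contractedIntegral p a := by
  rw [LoadedCube.contractedIntegral, ← integral_const_mul]
  congr 1
  funext t
  have hX : (fun r => fderiv ℝ (c.face q e he).map t (Pi.single r 1)) =
      q.removeNth fun i => fderiv ℝ c.map (q.insertNth e t : Fin (k + 1) → ℝ) (Pi.single i 1) := by
    funext r
    exact fderiv_comp_insertNth (c.smooth.differentiable (by simp)) q e t r
  rw [hX, Form.map_cons_removeNth, ← mul_assoc, ← mul_pow]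
  simp [LoadedCube.face, contractedTangent]

/-- Stokes' formula on a cube. -/
theorem LoadedCube.integral_lieDeriv (hM : M = X.coords (k + 1)) (hg : QuasiHomogeneousFun g α)
    (hη : QuasiHomogeneousForm η β) (hX : X = .projective → DescendsToProjective J d η α β)
    (c : LoadedCube J g η U (k + 1)) {a : Idx J → ℂ} (ha : a ∈ U) (p : Fin M) :
    ∫ t in cube (k + 1), lieDeriv p (fun x => c.coeff a t (graphPt J a x)) (c.map t)
      (fun q => fderiv ℝ c.map t (Pi.single q 1)) =
    ∑ q : Fin (k + 1), (-1) ^ (q : ℕ) *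
      ((c.face q 1 ⟨zero_le_one, le_rfl⟩).contractedIntegral p a -
        (c.face q 0 ⟨le_rfl, zero_le_one⟩).contractedIntegral p a) := by
  let F : Fin (k + 1) → (Fin (k + 1) → ℝ) → ℂ := fun q t =>
    c.coeff a t (graphPt J a (c.map t)) (contractedTangent c.map p q t)
  -- In the open cube the coefficient is locally one function element and Cartan's formula computes
  -- the divergence. The divergence theorem asks only for continuity at the boundary.
  have hint : ∀ t ∈ Set.pi Set.univ (fun _ : Fin (k + 1) => Set.Ioo (0 : ℝ) 1),
      (∀ q, DifferentiableAt ℝ (F q) t) ∧ ∑ q, fderiv ℝ (F q) t (Pi.single q 1) =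
        lieDeriv p (fun x => c.coeff a t (graphPt J a x)) (c.map t)
          (fun q => fderiv ℝ c.map t (Pi.single q 1)) := by
    intro t₀ ht₀
    have hnhds : cube (k + 1) ∈ 𝓝 t₀ := by
      rw [cube, ← Set.pi_univ_Icc]
      exact set_pi_mem_nhds Set.finite_univ fun i _ => Icc_mem_nhds (ht₀ i trivial).1
        (ht₀ i trivial).2
    have hmem := mem_of_mem_nhds hnhds
    have hev : ∀ q, F q =ᶠ[𝓝 t₀] fun t =>
        (fun x => c.coeff a t₀ (graphPt J a x)) (c.map t) (contractedTangent c.map p q t) := by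
      intro q
      filter_upwards [c.coeff_eventuallyEq_of_mem_interior ha hnhds] with t ht
      simp only [F, ht]
    have hs := (c.isGermSection.holAt (a, t₀) ⟨ha, hmem⟩).hasFDerivAt_restrict_graph
    obtain ⟨h1, h2⟩ := sum_fderiv_contractedTangent c.smooth hs.differentiableAt p
    refine ⟨fun q => (h1 q).congr_of_eventuallyEq (hev q), ?_⟩
    rw [(c.coeff_mem a ha t₀ hmem).lieDeriv_eq_sum hM hg hη hX (c.polyMap_mem a ha t₀ hmem)
      (c.map_mem t₀ hmem) p]
    simp only [(hev _).fderiv_eq]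
    exact h2
  -- The boundary of the cube is a null set, so the divergence is integrable because the Lie
  -- derivative is.
  have hint' : (fun t => ∑ q, fderiv ℝ (F q) t (Pi.single q 1)) =ᵐ[volume.restrict (cube (k + 1))]
      fun t => lieDeriv p (fun x => c.coeff a t (graphPt J a x)) (c.map t)
          (fun q => fderiv ℝ c.map t (Pi.single q 1)) := by
    have hres : (volume : Measure (Fin (k + 1) → ℝ)).restrict (cube (k + 1)) =
        volume.restrict (Set.pi Set.univ fun _ => Set.Ioo (0 : ℝ) 1) :=
      (Measure.restrict_congr_set (Measure.univ_pi_Ioo_ae_eq_Icc (f := fun _ => (0 : ℝ))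
        (g := fun _ => (1 : ℝ)) (μ := fun _ : Fin (k + 1) => (volume : Measure ℝ)))).symm
    rw [hres]
    refine (ae_restrict_iff' (MeasurableSet.univ_pi fun _ => measurableSet_Ioo)).2
      (Eventually.of_forall fun t ht => (hint t ht).2)
  have hdiv := integral_divergence_of_hasFDerivAt_off_countable' (E := ℂ) (0 : Fin (k + 1) → ℝ) 1
    zero_le_one F (fun q t => fderiv ℝ (F q) t) ∅ Set.countable_empty (fun q => ?_)
    (fun t ht q => ((hint t ht.1).1 q).hasFDerivAt)
    ((c.integrableOn_lieDeriv hη ha p).congr_fun_ae hint'.symm)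
  · rw [← integral_congr_ae hint']
    refine hdiv.trans (Finset.sum_congr rfl fun q _ => ?_)
    rw [mul_sub]
    exact congrArg₂ (· - ·) (c.face_contractedIntegral a p q ⟨zero_le_one, le_rfl⟩)
      (c.face_contractedIntegral a p q ⟨le_rfl, zero_le_one⟩)
  · exact (c.isGermSection.continuousOn_integrand c.smooth.continuous
      (continuous_contractedTangent c.smooth p q)).comp
      (Continuous.prodMk_right a).continuousOn (fun _ ht => ⟨ha, ht⟩)

end Stokes
end AHyp

namespace AHyp

open MeasureTheory

/-! ### The contracted integral vanishes on zero chains -/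

section ContractedPeriod

variable {M n k : ℕ} {J : Fin n → Finset (Fin M → ℕ)} {D : Set (Fin n → ℂ)}
  {E : Set (Fin M → ℂ)} {g : MultivaluedHol (F := ℂ) D}
  {η : MultivaluedHol (F := Form M (k + 1)) E} {U : Set (Idx J → ℂ)} {X : Ambient}
  {d : Fin n → ℕ} {α : Fin n → ℂ} {β : Fin M → ℂ}

theorem LoadedCube.integrableOn_contracted (c : LoadedCube J g η U k) {a : Idx J → ℂ}
    (ha : a ∈ U) (p : Fin M) : IntegrableOn (fun t => c.coeff a t (graphPt J a (c.map t))
      (Matrix.vecCons (Pi.single p (c.map t p)) fun q => fderiv ℝ c.map t (Pi.single q 1)))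
      (cube k) := by
  have hu : Continuous fun t => (Matrix.vecCons (Pi.single p (c.map t p))
      fun q => fderiv ℝ c.map t (Pi.single q 1) : Fin (k + 1) → Fin M → ℂ) := by
    refine continuous_pi fun i => Fin.cases ?_ (fun q => ?_) i
    · exact (continuous_single p).comp ((continuous_apply p).comp c.smooth.continuous)
    · exact continuous_fderiv_single c.smooth q
  exact ((c.isGermSection.continuousOn_integrand c.smooth.continuous hu).comp
    (Continuous.prodMk_right a).continuousOn (fun _ ht => ⟨ha, ht⟩)).integrableOn_compact
    (isCompact_cube k)

theorem IsLinearCombination.contractedIntegral {c c₁ c₂ : LoadedCube J g η U k} {r₁ r₂ : ℂ}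
    (h : IsLinearCombination c r₁ r₂ c₁ c₂) {a : Idx J → ℂ} (ha : a ∈ U) (p : Fin M) :
    c.contractedIntegral p a =
      r₁ * c₁.contractedIntegral p a + r₂ * c₂.contractedIntegral p a := by
  simp only [LoadedCube.contractedIntegral]
  rw [← integral_const_mul, ← integral_const_mul, ← integral_add
    ((c₁.integrableOn_contracted ha p).const_mul _) ((c₂.integrableOn_contracted ha p).const_mul _)]
  refine setIntegral_congr_fun measurableSet_Icc fun t ht => ?_
  obtain ⟨h1, h2, h3⟩ := h t ht
  have hd : ∀ c' : LoadedCube J g η U k, Differentiable ℝ c'.map := fun c' =>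
    c'.smooth.differentiable (by simp)
  have e1 := fderiv_eq_of_eqOn_cube (hd c₁) (hd c) (fun t ht => (h t ht).1) ht
  have e2 := fderiv_eq_of_eqOn_cube (hd c₂) (hd c) (fun t ht => (h t ht).2.1) ht
  simp only [h1, h2, e1, e2, (h3 a ha).self_of_nhds]
  rfl

theorem IsDegenerate.contractedIntegral {c : LoadedCube J g η U k} (h : IsDegenerate c)
    (a : Idx J → ℂ) (p : Fin M) : c.contractedIntegral p a = 0 := by
  obtain ⟨q, hq⟩ := h
  refine setIntegral_eq_zero_of_forall_eq_zero fun t ht => ?_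
  refine ContinuousAlternatingMap.map_coord_zero _ q.succ ?_
  rw [Matrix.cons_val_succ]
  exact fderiv_single_eq_zero_of_const (c.smooth.differentiable (by simp)) hq ht

/-- The tangent vectors of `l φ` are `l` times those of `φ` plus multiples of the base point, which
the form kills; the vector `x_p ∂/∂x_p` is also multiplied by `l`. The contracted vector and the `k`
tangent vectors together give `l^(k+1)`, exactly the factor in the identification of coefficients.
-/
theorem IsRescaling.contractedIntegral (hX : DescendsToProjective J d η α β)
    {c c' : LoadedCube J g η U k} (h : IsRescaling d c c') {a : Idx J → ℂ} (ha : a ∈ U)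
    (p : Fin M) : c.contractedIntegral p a = c'.contractedIntegral p a := by
  obtain ⟨l, hl, h⟩ := h
  refine setIntegral_congr_fun measurableSet_Icc fun t ht => ?_
  obtain ⟨hl0, hmap, hcoeff⟩ := h t ht
  have hld : HasFDerivAt l (fderiv ℝ l t) t := (hl.differentiable (by simp) t).hasFDerivAt
  have hcd : HasFDerivAt c.map (fderiv ℝ c.map t) t :=
    (c.smooth.differentiable (by simp) t).hasFDerivAt
  have hder : fderiv ℝ c'.map t = fderiv ℝ (fun t => l t • c.map t) t :=
    fderiv_eq_of_eqOn_cube (c'.smooth.differentiable (by simp))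
      ((hl.differentiable (by simp)).smul (c.smooth.differentiable (by simp)))
      (fun t ht => (h t ht).2.1) ht
  have hpt : ((fun i => l t ^ d i * (graphPt J a (c.map t)).1 i), l t • (graphPt J a (c.map t)).2) =
      graphPt J a (c'.map t) := by
    rw [hmap, graphPt_smul hX.homogeneous]
    rfl
  set f := c'.coeff a t (graphPt J a (c'.map t)) with hf
  have hker : ∀ (u : Fin (k + 1) → Fin M → ℂ) (q : Fin (k + 1)), u q = c'.map t → f u = 0 :=
    fun u q hu => (c'.coeff_mem a ha t ht).map_eq_zero_of_eq_snd hX (c'.map_mem t ht) u q hu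
  have hvec : (Matrix.vecCons (Pi.single p (c'.map t p))
      fun q => fderiv ℝ c'.map t (Pi.single q 1) : Fin (k + 1) → Fin M → ℂ) =
      fun i => l t • (Matrix.vecCons (Pi.single p (c.map t p))
        fun q => fderiv ℝ c.map t (Pi.single q 1) : Fin (k + 1) → Fin M → ℂ) i +
        (Matrix.vecCons 0 (fun q => fderiv ℝ l t (Pi.single q 1) * (l t)⁻¹) : Fin (k + 1) → ℂ) i •
          c'.map t := by
    funext i
    refine Fin.cases ?_ (fun q => ?_) i
    · ext r
      simp [hmap, Pi.single_apply]
    · simp only [Matrix.cons_val_succ, hder, hmap, smul_smul,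
        inv_mul_cancel_right₀ hl0]
      rw [HasFDerivAt.fderiv (hld.fun_smul hcd)]
      rfl
  show c.coeff a t _ _ = f _
  rw [hvec, f.map_add_smul_of_forall_eq_zero hker, (hcoeff a ha).self_of_nhds]
  beta_reduce
  rw [hpt, ← hf]
  have := f.toMultilinearMap.map_smul_univ (fun _ => l t) (Matrix.vecCons (Pi.single p (c.map t p))
        fun q => fderiv ℝ c.map t (Pi.single q 1) : Fin (k + 1) → Fin M → ℂ)
  rw [Finset.prod_const, Finset.card_univ, Fintype.card_fin] at this
  exact this.symm

/-- The integral of the contracted form over a chain. -/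
noncomputable def contractedPeriod (p : Fin M) (a : Idx J → ℂ) : PreChain J g η U k →ₗ[ℂ] ℂ :=
  Finsupp.linearCombination ℂ fun c => c.contractedIntegral p a

theorem contractedPeriod_eq_zero (hX : X = .projective → DescendsToProjective J d η α β)
    {C : PreChain J g η U k} (hC : C ∈ zeroChains X d U k) {a : Idx J → ℂ} (ha : a ∈ U)
    (p : Fin M) : contractedPeriod p a C = 0 := by
  have hle : zeroChains X d U k ≤
      LinearMap.ker (contractedPeriod (g := g) (η := η) (U := U) p a) := by
    refine Submodule.span_le.2 ?_
    rintro Z ((⟨c, c₁, c₂, r₁, r₂, h, rfl⟩ | ⟨c, h, rfl⟩) | ⟨hXp, c, c', h, rfl⟩)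
    · simp [contractedPeriod, h.contractedIntegral ha p]
    · simp [contractedPeriod, h.contractedIntegral a p]
    · simp [contractedPeriod, h.contractedIntegral (hX hXp) ha p]
  exact hle hC

theorem sum_integral_lieDeriv (hM : M = X.coords (k + 1)) (hg : QuasiHomogeneousFun g α)
    (hη : QuasiHomogeneousForm η β) (hX : X = .projective → DescendsToProjective J d η α β)
    (C : PreChain J g η U (k + 1)) {a : Idx J → ℂ} (ha : a ∈ U) (p : Fin M) :
    (C.sum fun c r => r * ∫ t in cube (k + 1), lieDeriv p (fun x => c.coeff a t (graphPt J a x))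
      (c.map t) (fun q => fderiv ℝ c.map t (Pi.single q 1))) =
      contractedPeriod p a (boundary C) := by
  rw [boundary, Finsupp.sum, Finsupp.sum, map_sum]
  refine Finset.sum_congr rfl fun c _ => ?_
  rw [c.integral_lieDeriv hM hg hη hX ha p, Finset.mul_sum, map_sum]
  refine Finset.sum_congr rfl fun q _ => ?_
  simp only [map_smul, map_sub, contractedPeriod, Finsupp.linearCombination_single, smul_eq_mul]
  ring

end ContractedPeriod

/-! ### Homogeneity equations for the coordinates and the hypergeometric system -/

section Homogeneity

variable {M m n : ℕ} {J : Fin n → Finset (Fin M → ℕ)} {D : Set (Fin n → ℂ)}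
  {E : Set (Fin M → ℂ)} {g : MultivaluedHol (F := ℂ) D}
  {η : MultivaluedHol (F := Form M m) E} {U : Set (Idx J → ℂ)} {X : Ambient}
  {d : Fin n → ℕ} {α : Fin n → ℂ} {β : Fin M → ℂ}

theorem sum_integral_lieDeriv_eq_zero (hM : M = X.coords m) (hg : QuasiHomogeneousFun g α)
    (hη : QuasiHomogeneousForm η β) (hX : X = .projective → DescendsToProjective J d η α β)
    (C : PreChain J g η U m) (hC : IsCycle X d C) {a : Idx J → ℂ} (ha : a ∈ U) (p : Fin M) :
    (C.sum fun c r => r * ∫ t in cube m, lieDeriv p (fun x => c.coeff a t (graphPt J a x))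
      (c.map t) (fun q => fderiv ℝ c.map t (Pi.single q 1))) = 0 := by
  cases m with
  | zero =>
    -- For `m = 0` being a cycle is no condition; the integrand itself vanishes, since Cartan's
    -- formula is then a sum over no slots.
    refine Finset.sum_eq_zero fun c _ => ?_
    simp only
    rw [setIntegral_eq_zero_of_forall_eq_zero, mul_zero]
    intro t ht
    rw [(c.coeff_mem a ha t ht).lieDeriv_eq_sum hM hg hη hX (c.polyMap_mem a ha t ht)
      (c.map_mem t ht) p]
    simp
  | succ k =>
    rw [sum_integral_lieDeriv hM hg hη hX C ha p]
    exact contractedPeriod_eq_zero hX hC ha p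

/-- The homogeneity equations for the coordinates `x_p`. -/
theorem homogeneity_period_inr (hM : M = X.coords m) (hg : QuasiHomogeneousFun g α)
    (hη : QuasiHomogeneousForm η β) (hX : X = .projective → DescendsToProjective J d η α β)
    (hU : IsOpen U) (C : PreChain J g η U m) (hC : IsCycle X d C) {a : Idx J → ℂ} (ha : a ∈ U)
    (p : Fin M) :
    ∑ k, (exponentVectors J k (Sum.inr p) : ℂ) * a k * fderiv ℂ (period C) a (Pi.single k 1) =
      - β p * period C a := by
  rw [sum_mul_fderiv_period hU C ha, neg_mul, ← add_eq_zero_iff_eq_neg, period, Finsupp.mul_sum,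
    ← sum_integral_lieDeriv_eq_zero hM hg hη hX C hC ha p, Finsupp.sum, Finsupp.sum,
    ← Finset.sum_add_distrib]
  refine Finset.sum_congr rfl fun c _ => ?_
  rw [mul_left_comm (β p), LoadedCube.integral, ← integral_const_mul (β p), ← mul_add,
    ← integral_add]
  · refine congrArg (C c * ·) (setIntegral_congr_fun measurableSet_Icc fun t ht => ?_)
    show _ = _
    rw [(c.coeff_mem a ha t ht).lieDeriv_restrict_graph hη (c.polyMap_mem a ha t ht)
      (c.map_mem t ht) p]
    simp [exponentVectors]
  · exact integrable_finsetSum _ fun k _ =>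
      ((c.isGermSection.coeffDeriv k).integrableOn c.smooth ha).const_mul _
  · exact (c.isGermSection.integrableOn c.smooth ha).const_mul _

theorem isAHypergeometric_period (hM : M = X.coords m) (hg : QuasiHomogeneousFun g α)
    (hη : QuasiHomogeneousForm η β) (hX : X = .projective → DescendsToProjective J d η α β)
    (hU : IsOpen U) (C : PreChain J g η U m) (hC : IsCycle X d C) :
    IsAHypergeometric (exponentVectors J) (Sum.elim α fun p => - β p) U (period C) where
  holomorphic := differentiableOn_period hU C
  homogeneity r a ha := by
    cases r with
    | inl i => exact homogeneity_period_inl hg hU C ha i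
    | inr p => exact homogeneity_period_inr hM hg hη hX hU C hC ha p
  box q q' k l hkl a ha := by
    rw [iteratedFDeriv_period hU C q k ha, iteratedFDeriv_period hU C q' l ha]
    refine derivPeriod_congr C ?_ ha
    simpa [List.map_ofFn, List.sum_ofFn] using hkl

end Homogeneity
end AHyp

namespace AHyp

/-! ### Analytic continuation of cycles in the coefficients -/

section Extension

variable {M m n k : ℕ} {J : Fin n → Finset (Fin M → ℕ)} {D : Set (Fin n → ℂ)}
  {E : Set (Fin M → ℂ)} {g : MultivaluedHol (F := ℂ) D}
  {η : MultivaluedHol (F := Form M m) E} {U : Set (Idx J → ℂ)} {X : Ambient}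
  {d : Fin n → ℕ} {a₀ : Idx J → ℂ}

/-- `c'` is an analytic continuation of `c` to the coefficients `a ∈ U`. -/
def IsContinuation (c : LoadedCube J g η {a₀} k) (c' : LoadedCube J g η U k) : Prop :=
  c'.map = c.map ∧ ∀ t ∈ cube k, c'.coeff a₀ t =ᶠ[𝓝 (graphPt J a₀ (c.map t))] c.coeff a₀ t

theorem LoadedCube.isGermSection_of_mem_cube (c : LoadedCube J g η U k) {t : Fin k → ℝ}
    (ht : t ∈ cube k) :
    IsGermSection U (fun a => graphPt J a (c.map t)) (fun a => c.coeff a t) :=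
  c.isGermSection.comp_param (k := fun a => (a, t)) (Continuous.prodMk_left t).continuousOn
    (fun _ ha => ⟨ha, ht⟩)

theorem continuous_graphPt_left (x : Fin M → ℂ) : Continuous fun a : Idx J → ℂ => graphPt J a x :=
  continuous_graphPt.comp (Continuous.prodMk_left x)

/-- A coefficient over a cube is given by holomorphic function elements on balls of constant
radius. -/
theorem LoadedCube.exists_uniform_radius (c : LoadedCube J g η {a₀} k) :
    ∃ r > 0, ∀ t ∈ cube k, ∃ s : (Fin n → ℂ) × (Fin M → ℂ) → Form M m,
      s =ᶠ[𝓝 (graphPt J a₀ (c.map t))] c.coeff a₀ t ∧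
      ∀ y ∈ Metric.ball (graphPt J a₀ (c.map t)) r, y.1 ∈ D ∧ y.2 ∈ E ∧ InLocalSystem g η y s := by
  -- Membership in the cube is repeated because induction over the compact set runs through
  -- arbitrary subsets of `ℝ^k`.
  suffices h : ∃ r > 0, ∀ t ∈ cube k, t ∈ cube k → ∃ s : (Fin n → ℂ) × (Fin M → ℂ) → Form M m,
      s =ᶠ[𝓝 (graphPt J a₀ (c.map t))] c.coeff a₀ t ∧
      ∀ y ∈ Metric.ball (graphPt J a₀ (c.map t)) r,
        y.1 ∈ D ∧ y.2 ∈ E ∧ InLocalSystem g η y s by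
    obtain ⟨r, hr, h⟩ := h
    exact ⟨r, hr, fun t ht => h t ht ht⟩
  refine (isCompact_cube k).induction_on (p := fun K => ∃ r > 0, ∀ t ∈ K, t ∈ cube k →
    ∃ s : (Fin n → ℂ) × (Fin M → ℂ) → Form M m,
      s =ᶠ[𝓝 (graphPt J a₀ (c.map t))] c.coeff a₀ t ∧
      ∀ y ∈ Metric.ball (graphPt J a₀ (c.map t)) r, y.1 ∈ D ∧ y.2 ∈ E ∧ InLocalSystem g η y s)
    ⟨1, one_pos, by simp⟩ ?_ ?_ ?_
  · rintro K K' hKK' ⟨r, hr, h⟩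
    exact ⟨r, hr, fun t ht => h t (hKK' ht)⟩
  · rintro K K' ⟨r, hr, h⟩ ⟨r', hr', h'⟩
    refine ⟨min r r', lt_min hr hr', fun t ht htc => ?_⟩
    rcases ht with ht | ht
    · obtain ⟨s, hs, hb⟩ := h t ht htc
      exact ⟨s, hs, fun y hy => hb y (Metric.ball_subset_ball (min_le_left _ _) hy)⟩
    · obtain ⟨s, hs, hb⟩ := h' t ht htc
      exact ⟨s, hs, fun y hy => hb y (Metric.ball_subset_ball (min_le_right _ _) hy)⟩
  · intro t₀ ht₀
    have hD := c.polyMap_mem a₀ rfl t₀ ht₀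
    have hE := c.map_mem t₀ ht₀
    have hev : ∀ᶠ y in 𝓝 (graphPt J a₀ (c.map t₀)),
        y.1 ∈ D ∧ y.2 ∈ E ∧ InLocalSystem g η y (c.coeff a₀ t₀) :=
      (continuousAt_fst.eventually (g.isOpen.mem_nhds hD)).and
        ((continuousAt_snd.eventually (η.isOpen.mem_nhds hE)).and
          ((c.coeff_mem a₀ rfl t₀ ht₀).eventually hD hE))
    obtain ⟨r, hr, hball⟩ := Metric.eventually_nhds_iff_ball.1 hev
    have hγ : ContinuousOn (fun t => graphPt J a₀ (c.map t)) (cube k) :=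
      ((differentiable_graphPt a₀).continuous.comp c.smooth.continuous).continuousOn
    have h1 : Tendsto (fun t : Fin k → ℝ => (a₀, t)) (𝓝[cube k] t₀)
        (𝓝[{a₀} ×ˢ cube k] (a₀, t₀)) :=
      (Continuous.prodMk_right a₀).continuousWithinAt.tendsto_nhdsWithin
        (fun t ht => ⟨rfl, ht⟩)
    refine ⟨_, (h1.eventually (c.coeff_locallyConstant a₀ rfl t₀ ht₀)).and
      ((hγ t₀ ht₀).eventually (Metric.ball_mem_nhds _ (half_pos hr))), r / 2, half_pos hr, ?_⟩
    rintro t ⟨ht1, ht2⟩ -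
    -- For `t` near `t₀` the function element at `t₀` represents the coefficient, and the ball of
    -- radius `r / 2` at the new graph point lies in that of radius `r` at the old one.
    refine ⟨c.coeff a₀ t₀, ht1.symm, fun y hy => hball y ?_⟩
    have h3 := (dist_triangle y (graphPt J a₀ (c.map t)) (graphPt J a₀ (c.map t₀)))
    have h4 : dist (graphPt J a₀ (c.map t)) (graphPt J a₀ (c.map t₀)) < r / 2 := ht2
    rw [Metric.mem_ball] at hy ⊢
    linarith

/-- Every loaded cube can be continued analytically to nearby coefficients. -/
theorem LoadedCube.exists_isContinuation (c : LoadedCube J g η {a₀} k) :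
    ∀ᶠ δ in 𝓝[>] (0 : ℝ), ∃ c' : LoadedCube J g η (Metric.ball a₀ δ) k, IsContinuation c c' := by
  obtain ⟨r, hr, h⟩ := c.exists_uniform_radius
  choose! s hs hball using h
  have hclose : ∀ᶠ a in 𝓝 a₀, ∀ t ∈ cube k,
      dist (graphPt J a (c.map t)) (graphPt J a₀ (c.map t)) < r := by
    refine (isCompact_cube k).eventually_forall_of_forall_eventually fun t _ => ?_
    have hc : Continuous fun p : (Idx J → ℂ) × (Fin k → ℝ) =>
        dist (graphPt J p.1 (c.map p.2)) (graphPt J a₀ (c.map p.2)) :=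
      (continuous_graphPt.comp (continuous_fst.prodMk (c.smooth.continuous.comp
        continuous_snd))).dist ((differentiable_graphPt a₀).continuous.comp
          (c.smooth.continuous.comp continuous_snd))
    exact hc.continuousAt.eventually (gt_mem_nhds (by simpa using hr))
  obtain ⟨δ₀, hδ₀, hδ⟩ := Metric.eventually_nhds_iff_ball.1 hclose
  filter_upwards [Ioo_mem_nhdsGT hδ₀] with δ hδδ
  have hmem : ∀ a ∈ Metric.ball a₀ δ, ∀ t ∈ cube k,
      graphPt J a (c.map t) ∈ Metric.ball (graphPt J a₀ (c.map t)) r := fun a ha t ht =>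
    hδ a (Metric.ball_subset_ball hδδ.2.le ha) t ht
  have hdiff : ∀ t ∈ cube k, DifferentiableOn ℂ (s t)
      (Metric.ball (graphPt J a₀ (c.map t)) r) := fun t ht y hy => by
    obtain ⟨h1, h2, h3⟩ := hball t ht y hy
    exact (h3.holAt h1 h2).differentiableAt.differentiableWithinAt
  refine ⟨{
    map := c.map
    -- The function element does not depend on `a`: for `a` near `a₀` the graph point stays in the
    -- ball on which `s t` is defined.
    coeff := fun _ t => s t
    smooth := c.smooth
    map_mem := c.map_mem
    polyMap_mem := fun a ha t ht => (hball t ht _ (hmem a ha t ht)).1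
    coeff_mem := fun a ha t ht => (hball t ht _ (hmem a ha t ht)).2.2
    coeff_locallyConstant := fun a₁ ha₁ t₁ ht₁ => ?_ }, rfl, fun t ht => hs t ht⟩
  have hproj : Tendsto (fun p : (Idx J → ℂ) × (Fin k → ℝ) => (a₀, p.2))
      (𝓝[Metric.ball a₀ δ ×ˢ cube k] (a₁, t₁)) (𝓝[{a₀} ×ˢ cube k] (a₀, t₁)) :=
    (continuous_const.prodMk continuous_snd).continuousWithinAt.tendsto_nhdsWithin
      (fun p hp => ⟨rfl, hp.2⟩)
  have hγ₀ : Continuous fun p : (Idx J → ℂ) × (Fin k → ℝ) => graphPt J a₀ (c.map p.2) :=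
    (differentiable_graphPt a₀).continuous.comp (c.smooth.continuous.comp continuous_snd)
  have hγ : Continuous fun p : (Idx J → ℂ) × (Fin k → ℝ) => graphPt J p.1 (c.map p.2) :=
    continuous_graphPt.comp (continuous_fst.prodMk (c.smooth.continuous.comp continuous_snd))
  filter_upwards [self_mem_nhdsWithin,
    hproj.eventually (c.coeff_locallyConstant a₀ rfl t₁ ht₁),
    nhdsWithin_le_nhds (hγ₀.continuousAt.eventually (hs t₁ ht₁).eventuallyEq_nhds),
    nhdsWithin_le_nhds (hγ₀.continuousAt.eventually (Metric.ball_mem_nhds _ hr)),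
    nhdsWithin_le_nhds (hγ.continuousAt.eventually
      (Metric.isOpen_ball.mem_nhds (hmem a₁ ha₁ t₁ ht₁)))] with p hp h1 h2 h3 h4
  have hgerm : s p.2 =ᶠ[𝓝 (graphPt J a₀ (c.map p.2))] s t₁ :=
    ((hs p.2 hp.2).trans h1).trans h2.symm
  -- The intersection of the two balls is convex and contains the graph point for `a₀`, where the
  -- germs agree, and the graph point for `a`, where agreement is wanted.
  have hopen : IsOpen (Metric.ball (graphPt J a₀ (c.map p.2)) r ∩
      Metric.ball (graphPt J a₀ (c.map t₁)) r) := Metric.isOpen_ball.inter Metric.isOpen_ball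
  refine (eqOn_of_eventuallyEq_of_convex hopen ((convex_ball _ _).inter (convex_ball _ _))
    ((hdiff p.2 hp.2).mono Set.inter_subset_left) ((hdiff t₁ ht₁).mono Set.inter_subset_right)
    ⟨Metric.mem_ball_self hr, h3⟩ hgerm).eventuallyEq_of_mem
    (hopen.mem_nhds ⟨hmem p.1 hp.1 p.2 hp.2, h4⟩)

/-- For fixed `t` both sides are sections of germs over `U` in the variable `a`; they agree at `a₀`,
hence on all of the preconnected set `U`. -/
theorem IsContinuation.isLinearCombination (hU : IsPreconnected U) (ha₀ : a₀ ∈ U)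
    {c c₁ c₂ : LoadedCube J g η {a₀} k} {c' c₁' c₂' : LoadedCube J g η U k} {r₁ r₂ : ℂ}
    (h : IsContinuation c c') (h₁ : IsContinuation c₁ c₁') (h₂ : IsContinuation c₂ c₂')
    (hc : IsLinearCombination c r₁ r₂ c₁ c₂) : IsLinearCombination c' r₁ r₂ c₁' c₂' := by
  intro t ht
  obtain ⟨e₁, e₂, e⟩ := hc t ht
  have m₁ : c₁'.map t = c'.map t := by rw [h₁.1, h.1, e₁]
  have m₂ : c₂'.map t = c'.map t := by rw [h₂.1, h.1, e₂]
  refine ⟨m₁, m₂, fun a ha => ?_⟩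
  have s₁ := c₁'.isGermSection_of_mem_cube ht
  have s₂ := c₂'.isGermSection_of_mem_cube ht
  rw [m₁] at s₁
  rw [m₂] at s₂
  refine (c'.isGermSection_of_mem_cube ht).eventuallyEq_of_isPreconnected
    (s₁.linearCombination s₂ r₁ r₂) (continuous_graphPt_left _).continuousOn hU ha₀ ha ?_
  have k := h.2 t ht
  have k₁ := h₁.2 t ht
  have k₂ := h₂.2 t ht
  rw [e₁] at k₁
  rw [e₂] at k₂
  rw [h.1]
  filter_upwards [k, k₁, k₂, e a₀ rfl] with y w w₁ w₂ w₃
  rw [w, w₁, w₂, w₃]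

theorem IsContinuation.isDegenerate {c : LoadedCube J g η {a₀} k} {c' : LoadedCube J g η U k}
    (h : IsContinuation c c') (hc : IsDegenerate c) : IsDegenerate c' := by
  unfold IsDegenerate
  rw [h.1]
  exact hc

/-- Homogeneity makes `(z, x) ↦ (l^d z, l x)` send graph points of `f_a` to graph points of the same
`f_a`, for every `a`. The pulled back coefficient is therefore a section over `U`, and uniqueness of
continuation applies. -/
theorem IsContinuation.isRescaling (hU : IsPreconnected U) (ha₀ : a₀ ∈ U)
    (hJ : ∀ i, ∀ j ∈ J i, ∑ p, j p = d i) {c c₁ : LoadedCube J g η {a₀} k}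
    {c' c₁' : LoadedCube J g η U k} (h : IsContinuation c c') (h₁ : IsContinuation c₁ c₁')
    (hc : IsRescaling d c c₁) : IsRescaling d c' c₁' := by
  obtain ⟨l, hl, hc⟩ := hc
  refine ⟨l, hl, fun t ht => ?_⟩
  obtain ⟨hl0, hmap, e⟩ := hc t ht
  have hmap' : c₁'.map t = l t • c'.map t := by rw [h₁.1, h.1, hmap]
  refine ⟨hl0, hmap', fun a ha => ?_⟩
  have hk : Differentiable ℂ fun y : (Fin n → ℂ) × (Fin M → ℂ) =>
      ((fun i => l t ^ d i * y.1 i : Fin n → ℂ), l t • y.2) := by fun_prop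
  have hpt : ∀ a, ((fun i => l t ^ d i * (graphPt J a (c'.map t)).1 i : Fin n → ℂ),
      l t • (graphPt J a (c'.map t)).2) = graphPt J a (c₁'.map t) := fun a => by
    rw [hmap', graphPt_smul hJ]
    rfl
  refine (c'.isGermSection_of_mem_cube ht).eventuallyEq_of_isPreconnected
    ((c₁'.isGermSection_of_mem_cube ht).comp_smul hk (l t ^ m) fun a _ => hpt a)
    (continuous_graphPt_left _).continuousOn hU ha₀ ha ?_
  have k := h.2 t ht
  have k₁ := h₁.2 t ht
  rw [← h₁.1, ← hpt a₀] at k₁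
  rw [← h.1] at k
  have e := e a₀ rfl
  rw [← h.1] at e
  filter_upwards [k, hk.continuous.continuousAt.eventually k₁, e] with y w w₁ w₂
  rw [w, w₁, w₂]

theorem IsContinuation.face {c : LoadedCube J g η {a₀} (k + 1)} {c' : LoadedCube J g η U (k + 1)}
    (h : IsContinuation c c') (q : Fin (k + 1)) {e : ℝ} (he : e ∈ Set.Icc (0 : ℝ) 1) :
    IsContinuation (c.face q e he) (c'.face q e he) :=
  ⟨funext fun _ => congrFun h.1 _, fun _ ht => h.2 _ (insertNth_mem_cube q he ht)⟩

theorem isLinearCombination_refl (c : LoadedCube J g η U k) : IsLinearCombination c 1 0 c c :=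
  fun _ _ => ⟨rfl, rfl, fun _ _ => Eventually.of_forall fun _ => by
    ext u
    exact (by simp : ∀ z : ℂ, z = 1 * z + 0 * z) _⟩

theorem single_sub_single_mem_zeroChains {c c' : LoadedCube J g η U k}
    (h : IsLinearCombination c 1 0 c' c') :
    (Finsupp.single c 1 - Finsupp.single c' 1 : PreChain J g η U k) ∈ zeroChains X d U k :=
  Submodule.subset_span (Or.inl (Or.inl ⟨c, c', c', 1, 0, h, by simp⟩))

variable (J g η U a₀ k) in
open Classical in
/-- Analytic continuation of chains, cube by cube; cubes without a continuation to `U` are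
dropped. -/
noncomputable def continuation : PreChain J g η {a₀} k →ₗ[ℂ] PreChain J g η U k :=
  Finsupp.linearCombination ℂ fun c =>
    if h : ∃ c' : LoadedCube J g η U k, IsContinuation c c' then Finsupp.single h.choose 1 else 0

theorem exists_continuation_single {c : LoadedCube J g η {a₀} k}
    (h : ∃ c' : LoadedCube J g η U k, IsContinuation c c') :
    ∃ c' : LoadedCube J g η U k, IsContinuation c c' ∧
      ∀ r, continuation k J g η U a₀ (Finsupp.single c r) = Finsupp.single c' r :=
  ⟨h.choose, h.choose_spec, fun r => by simp [continuation, h]⟩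

theorem isPreconnected_coeff_ball (a₀ : Idx J → ℂ) (δ : ℝ) :
    IsPreconnected (Metric.ball a₀ δ) :=
  (convex_ball a₀ δ).isPreconnected

/-- The statement is for all sufficiently small `δ` so that finitely many relations, each with its
own radius, can be combined. These relations may involve cubes that have cancelled out of `Z`. -/
theorem continuation_mem_zeroChains (hJ : X = .projective → ∀ i, ∀ j ∈ J i, ∑ p, j p = d i)
    {Z : PreChain J g η {a₀} k} (hZ : Z ∈ zeroChains X d {a₀} k) :
    ∀ᶠ δ in 𝓝[>] (0 : ℝ), continuation k J g η (Metric.ball a₀ δ) a₀ Z ∈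
      zeroChains X d (Metric.ball a₀ δ) k := by
  refine Submodule.span_induction (p := fun Z _ => ∀ᶠ δ in 𝓝[>] (0 : ℝ),
    continuation k J g η (Metric.ball a₀ δ) a₀ Z ∈ zeroChains X d (Metric.ball a₀ δ) k)
    ?_ ?_ ?_ ?_ hZ
  · rintro Z ((⟨c, c₁, c₂, r₁, r₂, h, rfl⟩ | ⟨c, h, rfl⟩) | ⟨hXp, c, c₁, h, rfl⟩)
    · filter_upwards [c.exists_isContinuation, c₁.exists_isContinuation,
        c₂.exists_isContinuation, self_mem_nhdsWithin] with δ h0 h1 h2 hδ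
      obtain ⟨c', k0, e0⟩ := exists_continuation_single h0
      obtain ⟨c₁', k1, e1⟩ := exists_continuation_single h1
      obtain ⟨c₂', k2, e2⟩ := exists_continuation_single h2
      rw [map_sub, map_sub, e0, e1, e2]
      exact Submodule.subset_span (Or.inl (Or.inl ⟨c', c₁', c₂', r₁, r₂,
        k0.isLinearCombination (isPreconnected_coeff_ball _ _) (Metric.mem_ball_self hδ) k1 k2 h,
        rfl⟩))
    · filter_upwards [c.exists_isContinuation] with δ h0
      obtain ⟨c', k0, e0⟩ := exists_continuation_single h0
      rw [e0]
      exact Submodule.subset_span (Or.inl (Or.inr ⟨c', k0.isDegenerate h, rfl⟩))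
    · filter_upwards [c.exists_isContinuation, c₁.exists_isContinuation,
        self_mem_nhdsWithin] with δ h0 h1 hδ
      obtain ⟨c', k0, e0⟩ := exists_continuation_single h0
      obtain ⟨c₁', k1, e1⟩ := exists_continuation_single h1
      rw [map_sub, e0, e1]
      exact Submodule.subset_span (Or.inr ⟨hXp, c', c₁',
        k0.isRescaling (isPreconnected_coeff_ball _ _) (Metric.mem_ball_self hδ) (hJ hXp) k1 h,
        rfl⟩)
  · exact Eventually.of_forall fun δ => by rw [map_zero]; exact Submodule.zero_mem _
  · intro Z₁ Z₂ _ _ h₁ h₂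
    filter_upwards [h₁, h₂] with δ k₁ k₂
    rw [map_add]
    exact Submodule.add_mem _ k₁ k₂
  · intro r Z _ h
    filter_upwards [h] with δ k
    rw [map_smul]
    exact Submodule.smul_mem _ r k

theorem boundary_eq_linearCombination (C : PreChain J g η U (k + 1)) :
    boundary C = Finsupp.linearCombination ℂ (fun c : LoadedCube J g η U (k + 1) =>
      ∑ q : Fin (k + 1), (-1 : ℂ) ^ (q : ℕ) •
        (Finsupp.single (c.face q 1 ⟨zero_le_one, le_rfl⟩) (1 : ℂ) -
          Finsupp.single (c.face q 0 ⟨le_rfl, zero_le_one⟩) 1)) C := by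
  rw [boundary, Finsupp.linearCombination_apply]
  refine Finsupp.sum_congr fun c _ => ?_
  rw [Finset.smul_sum]
  refine Finset.sum_congr rfl fun q _ => ?_
  rw [smul_smul, mul_comm]

/-- The continuation chosen for a face need not be the face of the chosen continuation, but both
continue the same loaded cube and so agree up to zero chains. -/
theorem boundary_continuation_sub_mem_zeroChains (C : PreChain J g η {a₀} (k + 1)) :
    ∀ᶠ δ in 𝓝[>] (0 : ℝ), boundary (continuation (k + 1) J g η (Metric.ball a₀ δ) a₀ C) -
      continuation k J g η (Metric.ball a₀ δ) a₀ (boundary C) ∈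
        zeroChains X d (Metric.ball a₀ δ) k := by
  induction C using Finsupp.induction_linear with
  | zero =>
    refine Eventually.of_forall fun δ => ?_
    simp only [boundary_eq_linearCombination, map_zero, sub_zero]
    exact Submodule.zero_mem _
  | add C₁ C₂ h₁ h₂ =>
    filter_upwards [h₁, h₂] with δ k₁ k₂
    have := Submodule.add_mem _ k₁ k₂
    simp only [boundary_eq_linearCombination, map_add] at this ⊢
    rwa [add_sub_add_comm]
  | single c r =>
    have hf : ∀ q : Fin (k + 1), ∀ᶠ δ in 𝓝[>] (0 : ℝ),
        (∃ c' : LoadedCube J g η (Metric.ball a₀ δ) k,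
          IsContinuation (c.face q 1 ⟨zero_le_one, le_rfl⟩) c') ∧
        ∃ c' : LoadedCube J g η (Metric.ball a₀ δ) k,
          IsContinuation (c.face q 0 ⟨le_rfl, zero_le_one⟩) c' := fun q =>
      (LoadedCube.exists_isContinuation _).and (LoadedCube.exists_isContinuation _)
    filter_upwards [c.exists_isContinuation, eventually_all.2 hf, self_mem_nhdsWithin]
      with δ h0 hf hδ
    obtain ⟨c', k0, e0⟩ := exists_continuation_single h0
    rw [e0]
    simp only [boundary_eq_linearCombination, Finsupp.linearCombination_single, map_smul, map_sum,
      map_sub]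
    rw [← smul_sub, ← Finset.sum_sub_distrib]
    refine Submodule.smul_mem _ r (Submodule.sum_mem _ fun q _ => ?_)
    rw [← smul_sub, sub_sub_sub_comm]
    refine Submodule.smul_mem _ _ (Submodule.sub_mem _ ?_ ?_)
    · obtain ⟨c₁, k1, e1⟩ := exists_continuation_single (hf q).1
      rw [e1]
      exact single_sub_single_mem_zeroChains ((k0.face q _).isLinearCombination
        (isPreconnected_coeff_ball _ _) (Metric.mem_ball_self hδ) k1 k1
        (isLinearCombination_refl _))
    · obtain ⟨c₁, k1, e1⟩ := exists_continuation_single (hf q).2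
      rw [e1]
      exact single_sub_single_mem_zeroChains ((k0.face q _).isLinearCombination
        (isPreconnected_coeff_ball _ _) (Metric.mem_ball_self hδ) k1 k1
        (isLinearCombination_refl _))

theorem restrict_continuation_sub_mem_zeroChains (C : PreChain J g η {a₀} k) :
    ∀ᶠ δ in 𝓝[>] (0 : ℝ), ∀ h : {a₀} ⊆ Metric.ball a₀ δ,
      (continuation k J g η (Metric.ball a₀ δ) a₀ C).mapDomain (LoadedCube.restrict h) - C ∈
        zeroChains X d {a₀} k := by
  induction C using Finsupp.induction_linear with
  | zero =>
    refine Eventually.of_forall fun δ h => ?_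
    rw [map_zero, Finsupp.mapDomain_zero, sub_zero]
    exact Submodule.zero_mem _
  | add C₁ C₂ h₁ h₂ =>
    filter_upwards [h₁, h₂] with δ k₁ k₂ h
    rw [map_add, Finsupp.mapDomain_add, add_sub_add_comm]
    exact Submodule.add_mem _ (k₁ h) (k₂ h)
  | single c r =>
    filter_upwards [c.exists_isContinuation] with δ h0 h
    obtain ⟨c', k0, e0⟩ := exists_continuation_single h0
    rw [e0, Finsupp.mapDomain_single]
    have hlin : IsLinearCombination (c'.restrict h) 1 0 c c := fun t ht => by
      have hm : c.map t = (c'.restrict h).map t := (congrFun k0.1 t).symm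
      refine ⟨hm, hm, fun a ha => ?_⟩
      obtain rfl : a = a₀ := ha
      rw [← hm]
      filter_upwards [k0.2 t ht] with y hy
      ext u
      show (_ : ℂ) = (1 : ℂ) * (_ : ℂ) + (0 : ℂ) * (_ : ℂ)
      rw [one_mul, zero_mul, add_zero, ← hy]
      rfl
    have := Submodule.smul_mem _ r (single_sub_single_mem_zeroChains (X := X) (d := d) hlin)
    simpa [smul_sub] using this

/-- Every cycle extends to nearby coefficients. -/
theorem exists_isCycle_extension (hJ : X = .projective → ∀ i, ∀ j ∈ J i, ∑ p, j p = d i)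
    (a₀ : Idx J → ℂ) (C : PreChain J g η {a₀} k) (hC : IsCycle X d C) :
    ∃ (U : Set (Idx J → ℂ)) (_ : IsOpen U) (ha₀ : {a₀} ⊆ U) (C' : PreChain J g η U k),
      IsCycle X d C' ∧ C'.mapDomain (LoadedCube.restrict ha₀) - C ∈ zeroChains X d {a₀} k := by
  have hcycle : ∀ᶠ δ in 𝓝[>] (0 : ℝ),
      IsCycle X d (continuation k J g η (Metric.ball a₀ δ) a₀ C) := by
    cases k with
    | zero => exact Eventually.of_forall fun _ => trivial
    | succ k =>
      filter_upwards [continuation_mem_zeroChains hJ (Z := boundary C) hC,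
        boundary_continuation_sub_mem_zeroChains (X := X) (d := d) C] with δ h1 h2
      -- The boundary of the continuation differs by a zero chain from the continuation of the
      -- boundary, which is itself a zero chain.
      have h := Submodule.add_mem _ h2 h1
      rw [sub_add_cancel] at h
      exact h
  obtain ⟨δ, h1, h2, hδ⟩ := (hcycle.and ((restrict_continuation_sub_mem_zeroChains
    (X := X) (d := d) C).and self_mem_nhdsWithin)).exists
  have ha₀ : {a₀} ⊆ Metric.ball a₀ δ := Set.singleton_subset_iff.2 (Metric.mem_ball_self hδ)
  exact ⟨_, Metric.isOpen_ball, ha₀, _, h1, h2 ha₀⟩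

end Extension
end AHyp

theorem mainTheorem1 (X : AHyp.Ambient) (m n : ℕ)
    (J : Fin n → Finset (Fin (X.coords m) → ℕ)) (d : Fin n → ℕ)
    (D : Set (Fin n → ℂ)) (E : Set (Fin (X.coords m) → ℂ))
    (g : AHyp.MultivaluedHol (F := ℂ) D)
    (η : AHyp.MultivaluedHol (F := AHyp.Form (X.coords m) m) E)
    (α : Fin n → ℂ) (β : Fin (X.coords m) → ℂ)
    (hg : AHyp.QuasiHomogeneousFun g α)
    (hη : AHyp.QuasiHomogeneousForm η β)
    (hX : X = .projective → AHyp.DescendsToProjective J d η α β) :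
    (∀ (a₀ : AHyp.Idx J → ℂ) (C : AHyp.PreChain J g η {a₀} m), AHyp.IsCycle X d C →
      ∃ (U : Set (AHyp.Idx J → ℂ)) (_ : IsOpen U) (ha₀ : {a₀} ⊆ U)
        (C' : AHyp.PreChain J g η U m), AHyp.IsCycle X d C' ∧
          C'.mapDomain (AHyp.LoadedCube.restrict ha₀) - C ∈ AHyp.zeroChains X d {a₀} m) ∧
    (∀ (U : Set (AHyp.Idx J → ℂ)), IsOpen U →
      ∀ C : AHyp.PreChain J g η U m, AHyp.IsCycle X d C →
        AHyp.IsAHypergeometric (AHyp.exponentVectors J) (Sum.elim α (fun p => - β p)) U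
          (AHyp.period C)) :=
  ⟨fun a₀ C hC => AHyp.exists_isCycle_extension (fun h => (hX h).homogeneous) a₀ C hC,
    fun _ hU C hC => AHyp.isAHypergeometric_period rfl hg hη hX hU C hC⟩
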